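/- Let $\mathbb{D}=\{z\in\mathbb{C}:|z|<1\}$ and $dA=\frac{dx\,dy}{\pi}$. A radial weight is a nonnegative function $\omega\in L^1(\mathbb{D},dA)$ with $\omega(z)=\omega(|z|)$ for all $z\in\mathbb{D}$. Put $\widehat\omega(r)=\int_r^1\omega(s)\,ds$ for $0\le r<1$. A radial weight $\omega$ is called regular, $\omega\in\mathcal{R}$, if $\widehat\omega(0)<\infty$, there is a constant $C\ge1$ with $\widehat\omega(r)\le C\,\widehat\omega\left(\frac{1+r}{2}\right)$ for all $0\le r<1$, and there are constants $0<c\le C'<\infty$ with $c\,\frac{\widehat\omega(r)}{1-r}\le\omega(r)\le C'\,\frac{\widehat\omega(r)}{1-r}$ for all $0\le r<1$. For $1\le p<\infty$ let $L^p_\omega=L^p(\mathbb{D},\omega\,dA)$, and let $A^p_\omega$ be the space of the analytic functions on $\mathbb{D}$ that belong to $L^p_\omega$, with the norm of $L^p_\omega$. **Theorem.** Let $1<p<\infty$, and let $\omega\in\mathcal{R}$ be not identically zero. Then for every $z\in\mathbb{D}$ the space $A^2_\omega$ has a reproducing kernel at $z$, that is, a function $B^\omega_z\in A^2_\omega$ such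 that $f(z)=\int_{\mathbb{D}}f(\zeta)\overline{B^\omega_z(\zeta)}\,\omega(\zeta)\,dA(\zeta)$ for all $f\in A^2_\omega$. For every $f\in L^p_\omega$ the integrals $$P_\omega(f)(z)=\int_{\mathbb{D}}f(\zeta)\overline{B^\omega_z(\zeta)}\,\omega(\zeta)\,dA(\zeta),\qquad P^+_\omega(f)(z)=\int_{\mathbb{D}}|f(\zeta)|\,|B^\omega_z(\zeta)|\,\omega(\zeta)\,dA(\zeta)$$ converge absolutely for every $z\in\mathbb{D}$. The positive Bergman operator $P^+_\omega$ is bounded from $L^p_\omega$ to $L^p_\omega$, and the Bergman projection $P_\omega$ is bounded from $L^p_\omega$ to $A^p_\omega$: there is a constant $C=C(p,\omega)$ such that for all $f\in L^p_\omega$ we have $P^+_\omega(f)\in L^p_\omega$, $P_\omega(f)\in A^p_\omega$, $$\|P^+_\omega(f)\|_{L^p_\omega}\le C\,\|f\|_{L^p_\omega}\qquad\text{and}\qquad\|P_\omega(f)\|_{A^p_\omega}\le C\,\|f\|_{L^p_\omega}.$$ -/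

import Mathlib

open MeasureTheory
open scoped ENNReal NNReal ComplexConjugate

noncomputable section

namespace BergmanProj

/-- The open unit disc. -/
def disc : Set ℂ := Metric.ball (0 : ℂ) 1

/-- The normalized area measure `dA = dx dy / π` on the unit disc. -/
def areaMeasure : Measure ℂ := ENNReal.ofReal Real.pi⁻¹ • volume.restrict disc

/-- A weight: a nonnegative function on the disc that is integrable there. -/
def IsWeight (ω : ℂ → ℝ) : Prop :=
  (∀ z ∈ disc, 0 ≤ ω z) ∧ Integrable ω areaMeasure

/-- `ω(z) = ω(|z|)` for all `z` in the disc. -/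
def IsRadial (ω : ℂ → ℝ) : Prop :=
  ∀ z ∈ disc, ω z = ω ((‖z‖ : ℝ) : ℂ)

/-- The tail integral `∫_r^1 ω(s) ds` of a radial weight. -/
def tail (ω : ℂ → ℝ) (r : ℝ) : ℝ := ∫ s in r..1, ω ((s : ℝ) : ℂ)

/-- Radial weights whose tail integral is doubling. The integrability clause says that the
tail integral is finite at `r = 0`, where integrability over the disc alone is not enough. -/
def IsDoubling (ω : ℂ → ℝ) : Prop :=
  IsWeight ω ∧ IsRadial ω ∧
    IntervalIntegrable (fun s : ℝ => ω ((s : ℝ) : ℂ)) volume 0 1 ∧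
    ∃ C : ℝ, 1 ≤ C ∧ ∀ r : ℝ, 0 ≤ r → r < 1 → tail ω r ≤ C * tail ω ((1 + r) / 2)

/-- Regular weights: doubling, and `ω(r)` is comparable to its average over `(r, 1)`. -/
def IsRegular (ω : ℂ → ℝ) : Prop :=
  IsDoubling ω ∧
    ∃ c C : ℝ, 0 < c ∧ 0 < C ∧ ∀ r : ℝ, 0 ≤ r → r < 1 →
      c * (tail ω r / (1 - r)) ≤ ω ((r : ℝ) : ℂ) ∧
        ω ((r : ℝ) : ℂ) ≤ C * (tail ω r / (1 - r))

/-- The measure `ω dA` on the unit disc; `L^p_ω` is the Lebesgue space of this measure. -/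
def weightedMeasure (ω : ℂ → ℝ) : Measure ℂ :=
  areaMeasure.withDensity fun z => ENNReal.ofReal (ω z)

/-- Membership in the Bergman space `A^p_ω`: analytic in the disc and in `L^p_ω`. -/
def MemBergman (ω : ℂ → ℝ) (p : ℝ≥0∞) (f : ℂ → ℂ) : Prop :=
  DifferentiableOn ℂ f disc ∧ MemLp f p (weightedMeasure ω)

/-- `K` is the reproducing kernel of `A²_ω` at the point `z`. -/
def IsReproducingKernelAt (ω : ℂ → ℝ) (z : ℂ) (K : ℂ → ℂ) : Prop :=
  MemBergman ω 2 K ∧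
    ∀ f : ℂ → ℂ, MemBergman ω 2 f → f z = ∫ ζ, f ζ * conj (K ζ) ∂(weightedMeasure ω)

/-- The Bergman reproducing kernel `B^ω_z(ζ)` (arbitrary if `A²_ω` has none at `z`). -/
def bergmanKernel (ω : ℂ → ℝ) (z : ℂ) : ℂ → ℂ :=
  Classical.epsilon fun K : ℂ → ℂ => IsReproducingKernelAt ω z K

/-- The Bergman projection `P_ω`, as an integral operator. -/
def bergmanProj (ω : ℂ → ℝ) (f : ℂ → ℂ) (z : ℂ) : ℂ :=
  ∫ ζ, f ζ * conj (bergmanKernel ω z ζ) ∂(weightedMeasure ω)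

/-- The positive Bergman operator `P⁺_ω`. -/
def bergmanProjPos (ω : ℂ → ℝ) (f : ℂ → ℂ) (z : ℂ) : ℝ :=
  ∫ ζ, ‖f ζ‖ * ‖bergmanKernel ω z ζ‖ ∂(weightedMeasure ω)

end BergmanProj

end

/-! The monomials are orthogonal in `A²_ω`, and the squared norm of `z ^ n` is the moment `m n = ∫ 2
r^(2n+1) ω(r) dr`. Hence the kernel is `F (conj z * ζ)` with `F w = ∑ w ^ n / m n`. It is bounded in
`ζ` for fixed `z`, so all the integrals converge for `f ∈ L^p_ω ⊆ L^1_ω`. What has to be proved is a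
size estimate for `F`, followed by Schur's test.

Write `V x` for the tail integral at distance `x` from the boundary. Doubling bounds the growth of
`V` above by a power; the lower bound on `ω` gives a reverse doubling, hence a positive lower
exponent (`IsRegular.regularTail`). The moments then satisfy `m n ≈ V (1 / (n + 1))`, and each
difference of `m`, up to the second order, gains a factor `1 / (n + 1)`
(`RegularTail.regularSequence`).

Let `S w = ∑ (n + 1)(n + 2) w ^ n / m n`, the second derivative of `w ^ 2 * F w`. Two summations by
parts show that `|1 - w|² |S w|` is at most a constant times `∑ |w| ^ n / m n`, hence a constant
times `1 / ((1 - |w|) V (1 - |w|))`. Integrating `S` twice along the ray from the origin recovers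
`F` (`recipSeries_eq_integral`). The mean of `|1 - t w|⁻²` over a circle is explicit, by the Poisson
kernel, and so the means of `|F|` over the circle of radius `ρ` are at most a constant times `1 / V
(1 - ρ)` (`lintegral_circle_recipSeries_le`).

In polar coordinates, with `ω(1 - u) ≤ B V u / u`, this shows that integrating `V (1 - |ζ|) ^ (-s)`
against `|B_z(ζ)| ω dA` costs only a constant, for every `0 < s < 1`
(`RegularTail.lintegral_absKernel_mul_le`). Schur's test with a power of `V` as test function bounds
`P⁺_ω`. The projection is dominated by `P⁺_ω`, and its values are sums of a power series in `z`. -/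

noncomputable section

namespace BergmanProj

open Set

/-! ### Power growth of the tail and its logarithmic integrals -/

/-- A positive increasing function on `(0, 1]` squeezed between two powers, uniformly in scale. -/
structure PowerGrowth (V : ℝ → ℝ) (κ γ : ℝ) (k : ℕ) : Prop where
  mono : Monotone V
  pos : ∀ x, 0 < x → 0 < V x
  one_le : 1 ≤ κ
  exponent_pos : 0 < γ
  upper : ∀ δ s, 0 < δ → δ ≤ s → s ≤ 1 → V s ≤ κ * (s / δ) ^ k * V δ
  lower : ∀ δ s, 0 < δ → δ ≤ s → s ≤ 1 → V δ ≤ κ * (δ / s) ^ γ * V s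

/-- Iterating the two dyadic inequalities compares `V` at `s` and at `s / 2 ^ n`. Monotonicity
handles the scales between consecutive dyadic ones, at the cost of one extra factor, which is
absorbed in `κ`. -/
theorem PowerGrowth.of_dyadic {V : ℝ → ℝ} (hV : Monotone V) (hpos : ∀ x, 0 < x → 0 < V x)
    {D q : ℝ} (hup : ∀ x, 0 < x → x ≤ 1 → V x ≤ D * V (x / 2))
    (hq : q < 1) (hlow : ∀ x, 0 < x → x ≤ 1 → V (x / 2) ≤ q * V x) :
    ∃ κ γ k, PowerGrowth V κ γ k := by
  have hD : 0 < D := by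
    have h1 := hup 1 one_pos le_rfl
    by_contra! h
    nlinarith [hpos 1 one_pos, hpos (1 / 2) (by norm_num)]
  have hq0 : 0 < q := by
    have h1 := hlow 1 one_pos le_rfl
    by_contra! h
    nlinarith [hpos 1 one_pos, hpos (1 / 2) (by norm_num)]
  -- The exponents come from `D < 2 ^ k` and `q = 2 ^ (-γ)`.
  obtain ⟨k, hk⟩ := pow_unbounded_of_one_lt D (one_lt_two (α := ℝ))
  set γ : ℝ := -Real.logb 2 q with hγ
  have hγpos : 0 < γ := by
    rw [hγ, neg_pos]; exact Real.logb_neg one_lt_two hq0 hq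
  have hqγ : q = (1 / 2 : ℝ) ^ γ := by
    rw [hγ, one_div, Real.inv_rpow (by norm_num), Real.rpow_neg (by norm_num), inv_inv,
      Real.rpow_logb (by norm_num) (by norm_num) hq0]
  have hupn : ∀ n : ℕ, ∀ x, 0 < x → x ≤ 1 → V x ≤ D ^ n * V (x / 2 ^ n) := by
    intro n
    induction n with
    | zero => intro x _ _; simp
    | succ n ih =>
      intro x hx hx1
      have h2 : x / 2 ^ n ≤ 1 := (div_le_self hx.le (one_le_pow₀ one_le_two)).trans hx1
      calc V x ≤ D ^ n * V (x / 2 ^ n) := ih x hx hx1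
        _ ≤ D ^ n * (D * V (x / 2 ^ n / 2)) := by gcongr; exact hup _ (by positivity) h2
        _ = _ := by rw [pow_succ, pow_succ, div_div]; ring
  have hlown : ∀ n : ℕ, ∀ x, 0 < x → x ≤ 1 → V (x / 2 ^ n) ≤ q ^ n * V x := by
    intro n
    induction n with
    | zero => intro x _ _; simp
    | succ n ih =>
      intro x hx hx1
      have h2 : x / 2 ^ n ≤ 1 := (div_le_self hx.le (one_le_pow₀ one_le_two)).trans hx1
      calc V (x / 2 ^ (n + 1)) = V (x / 2 ^ n / 2) := by rw [pow_succ, div_div]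
        _ ≤ q * V (x / 2 ^ n) := hlow _ (by positivity) h2
        _ ≤ q * (q ^ n * V x) := by gcongr; exact ih x hx hx1
        _ = _ := by ring
  have hscale : ∀ δ s : ℝ, 0 < δ → δ ≤ s → ∃ n : ℕ, δ ≤ s / 2 ^ n ∧ s / 2 ^ (n + 1) ≤ δ := by
    intro δ s hδ hs
    obtain ⟨n, h1, h2⟩ := exists_nat_pow_near (x := s / δ) ((one_le_div hδ).2 hs)
      (one_lt_two (α := ℝ))
    refine ⟨n, ?_, ?_⟩
    · rw [le_div_iff₀ (by positivity)]; rw [le_div_iff₀ hδ] at h1; linarith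
    · rw [div_le_iff₀ (by positivity)]; rw [div_lt_iff₀ hδ] at h2; linarith
  refine ⟨max (2 ^ k) (2 ^ γ), γ, k, hV, hpos, ?_, hγpos, ?_, ?_⟩
  · exact (one_le_pow₀ one_le_two).trans (le_max_left _ _)
  · intro δ s hδ hs hs1
    have hs0 : 0 < s := hδ.trans_le hs
    obtain ⟨n, h1, h2⟩ := hscale δ s hδ hs
    have hVδ := hpos δ hδ
    have h3 : (2 : ℝ) ^ (n + 1) ≤ 2 * (s / δ) := by
      rw [le_div_iff₀ (by positivity)] at h1
      rw [pow_succ, ← mul_div_assoc, le_div_iff₀ hδ]; linarith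
    calc V s ≤ D ^ (n + 1) * V (s / 2 ^ (n + 1)) := hupn _ s hs0 hs1
      _ ≤ (2 ^ k) ^ (n + 1) * V δ := by
          have := hV h2
          have := hpos (s / 2 ^ (n + 1)) (by positivity)
          gcongr
      _ = (2 ^ (n + 1)) ^ k * V δ := by rw [← pow_mul, ← pow_mul, mul_comm k]
      _ ≤ (2 * (s / δ)) ^ k * V δ := by gcongr
      _ = 2 ^ k * (s / δ) ^ k * V δ := by rw [mul_pow]
      _ ≤ _ := by gcongr; exact le_max_left _ _
  · intro δ s hδ hs hs1
    have hs0 : 0 < s := hδ.trans_le hs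
    obtain ⟨n, h1, h2⟩ := hscale δ s hδ hs
    have hVs := hpos s hs0
    have h3 : (1 / 2 : ℝ) ^ n ≤ 2 * (δ / s) := by
      rw [div_le_iff₀ (by positivity)] at h2
      rw [← mul_div_assoc, le_div_iff₀ hs0, one_div, inv_pow, inv_mul_le_iff₀ (by positivity)]
      rw [pow_succ] at h2; linarith
    calc V δ ≤ V (s / 2 ^ n) := hV h1
      _ ≤ q ^ n * V s := hlown n s hs0 hs1
      _ = ((1 / 2 : ℝ) ^ n) ^ γ * V s := by
          rw [hqγ, ← Real.rpow_natCast, ← Real.rpow_natCast, ← Real.rpow_mul (by norm_num),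
            ← Real.rpow_mul (by norm_num), mul_comm γ]
      _ ≤ (2 * (δ / s)) ^ γ * V s := by gcongr
      _ = 2 ^ γ * (δ / s) ^ γ * V s := by rw [Real.mul_rpow (by norm_num) (by positivity)]
      _ ≤ _ := by gcongr; exact le_max_right _ _

theorem lintegral_Ioi_rpow {a δ : ℝ} (ha : 0 < a) (hδ : 0 < δ) :
    ∫⁻ u in Ioi δ, ENNReal.ofReal (u ^ (-a - 1)) = ENNReal.ofReal (δ ^ (-a) / a) := by
  rw [← ofReal_integral_eq_lintegral_ofReal]
  · rw [integral_Ioi_rpow_of_lt (by linarith) hδ]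
    congr 1
    rw [sub_add_cancel, neg_div_neg_eq]
  · exact integrableOn_Ioi_rpow_of_lt (by linarith) hδ
  · filter_upwards [ae_restrict_mem measurableSet_Ioi] with u hu
    exact Real.rpow_nonneg (hδ.trans hu).le _

theorem lintegral_Ioo_zero_rpow {a δ : ℝ} (ha : 0 < a) (hδ : 0 < δ) :
    ∫⁻ u in Ioo 0 δ, ENNReal.ofReal (u ^ (a - 1)) = ENNReal.ofReal (δ ^ a / a) := by
  rw [← ofReal_integral_eq_lintegral_ofReal]
  · rw [← integral_Ioc_eq_integral_Ioo, ← intervalIntegral.integral_of_le hδ.le,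
      integral_rpow (Or.inl (by linarith)), sub_add_cancel, Real.zero_rpow ha.ne', sub_zero]
  · exact ((intervalIntegral.intervalIntegrable_rpow' (by linarith)).1).mono_set
      Ioo_subset_Ioc_self
  · filter_upwards [ae_restrict_mem measurableSet_Ioo] with u hu
    exact Real.rpow_nonneg hu.1.le _

namespace PowerGrowth

variable {V : ℝ → ℝ} {κ γ : ℝ} {k : ℕ}

/-- A bound for the part of a logarithmic integral of a negative power above the scale `δ`. -/
theorem lintegral_rpow_neg_le (h : PowerGrowth V κ γ k) {σ : ℝ} (hσ : 0 < σ) :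
    ∃ C : ℝ, 0 ≤ C ∧ ∀ δ, 0 < δ → ∫⁻ u in Ioo δ 1, ENNReal.ofReal (V u ^ (-σ) / u) ≤
      ENNReal.ofReal (C * V δ ^ (-σ)) := by
  have hκ : 0 < κ := one_pos.trans_le h.one_le
  have hγ := h.exponent_pos
  -- The lower exponent bounds the integrand by a multiple of `u ^ (-γσ - 1)`, whose integral over
  -- `(δ, ∞)` is `δ ^ (-γσ) / (γσ)`.
  refine ⟨κ ^ σ / (γ * σ), by positivity, fun δ hδ => ?_⟩
  have hVδ := h.pos δ hδ
  calc ∫⁻ u in Ioo δ 1, ENNReal.ofReal (V u ^ (-σ) / u)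
      ≤ ∫⁻ u in Ioo δ 1, ENNReal.ofReal (κ ^ σ * V δ ^ (-σ) * δ ^ (γ * σ)) *
          ENNReal.ofReal (u ^ (-(γ * σ) - 1)) := by
        refine setLIntegral_mono' measurableSet_Ioo fun u hu => ?_
        have hu0 : 0 < u := hδ.trans hu.1
        have hVu := h.pos u hu0
        rw [← ENNReal.ofReal_mul (by positivity)]
        refine ENNReal.ofReal_le_ofReal ?_
        have h1 : V δ ^ σ ≤ κ ^ σ * (δ ^ (γ * σ) * u ^ (-(γ * σ))) * V u ^ σ := by
          calc V δ ^ σ ≤ (κ * (δ / u) ^ γ * V u) ^ σ :=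
                Real.rpow_le_rpow hVδ.le (h.lower δ u hδ hu.1.le hu.2.le) hσ.le
            _ = _ := by
                rw [Real.mul_rpow (by positivity) hVu.le, Real.mul_rpow hκ.le (by positivity),
                  ← Real.rpow_mul (by positivity), Real.div_rpow hδ.le hu0.le,
                  Real.rpow_neg hu0.le, div_eq_mul_inv]
        rw [Real.rpow_sub hu0, Real.rpow_one, ← mul_div_assoc]
        refine div_le_div_of_nonneg_right ?_ hu0.le
        rw [Real.rpow_neg hVu.le, Real.rpow_neg hVδ.le, inv_le_iff_one_le_mul₀ (by positivity)]
        have h2 : 0 < V δ ^ σ := by positivity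
        calc (1 : ℝ) = V δ ^ σ * (V δ ^ σ)⁻¹ := (mul_inv_cancel₀ h2.ne').symm
          _ ≤ _ := mul_le_mul_of_nonneg_right h1 (by positivity)
          _ = _ := by ring
    _ = ENNReal.ofReal (κ ^ σ * V δ ^ (-σ) * δ ^ (γ * σ)) *
          ∫⁻ u in Ioo δ 1, ENNReal.ofReal (u ^ (-(γ * σ) - 1)) :=
        lintegral_const_mul' _ _ ENNReal.ofReal_ne_top
    _ ≤ ENNReal.ofReal (κ ^ σ * V δ ^ (-σ) * δ ^ (γ * σ)) *
          ∫⁻ u in Ioi δ, ENNReal.ofReal (u ^ (-(γ * σ) - 1)) := by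
        gcongr; exact Ioo_subset_Ioi_self
    _ = ENNReal.ofReal (κ ^ σ / (γ * σ) * V δ ^ (-σ)) := by
        rw [lintegral_Ioi_rpow (by positivity) hδ, ← ENNReal.ofReal_mul (by positivity)]
        congr 1
        rw [Real.rpow_neg hδ.le]
        have : δ ^ (γ * σ) ≠ 0 := by positivity
        field_simp

/-- A bound for the part of a logarithmic integral of a positive power below the scale `δ`. -/
theorem lintegral_rpow_le (h : PowerGrowth V κ γ k) {σ : ℝ} (hσ : 0 < σ) :
    ∃ C : ℝ, 0 ≤ C ∧ ∀ δ, 0 < δ → δ ≤ 1 → ∫⁻ u in Ioo 0 δ, ENNReal.ofReal (V u ^ σ / u) ≤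
      ENNReal.ofReal (C * V δ ^ σ) := by
  have hκ : 0 < κ := one_pos.trans_le h.one_le
  have hγ := h.exponent_pos
  refine ⟨κ ^ σ / (γ * σ), by positivity, fun δ hδ hδ1 => ?_⟩
  have hVδ := h.pos δ hδ
  calc ∫⁻ u in Ioo 0 δ, ENNReal.ofReal (V u ^ σ / u)
      ≤ ∫⁻ u in Ioo 0 δ, ENNReal.ofReal (κ ^ σ * V δ ^ σ * δ ^ (-(γ * σ))) *
          ENNReal.ofReal (u ^ (γ * σ - 1)) := by
        refine setLIntegral_mono' measurableSet_Ioo fun u hu => ?_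
        have hu0 : 0 < u := hu.1
        have hVu := h.pos u hu0
        rw [← ENNReal.ofReal_mul (by positivity)]
        refine ENNReal.ofReal_le_ofReal ?_
        rw [Real.rpow_sub hu0, Real.rpow_one, ← mul_div_assoc]
        refine div_le_div_of_nonneg_right ?_ hu0.le
        calc V u ^ σ ≤ (κ * (u / δ) ^ γ * V δ) ^ σ :=
              Real.rpow_le_rpow hVu.le (h.lower u δ hu0 hu.2.le hδ1) hσ.le
          _ = κ ^ σ * (u ^ (γ * σ) / δ ^ (γ * σ)) * V δ ^ σ := by
              rw [Real.mul_rpow (by positivity) hVδ.le, Real.mul_rpow hκ.le (by positivity),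
                ← Real.rpow_mul (by positivity), Real.div_rpow hu0.le hδ.le]
          _ = _ := by rw [Real.rpow_neg hδ.le, div_eq_mul_inv]; ring
    _ = ENNReal.ofReal (κ ^ σ * V δ ^ σ * δ ^ (-(γ * σ))) *
          ∫⁻ u in Ioo 0 δ, ENNReal.ofReal (u ^ (γ * σ - 1)) :=
        lintegral_const_mul' _ _ ENNReal.ofReal_ne_top
    _ = ENNReal.ofReal (κ ^ σ / (γ * σ) * V δ ^ σ) := by
        rw [lintegral_Ioo_zero_rpow (by positivity) hδ, ← ENNReal.ofReal_mul (by positivity)]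
        congr 1
        rw [Real.rpow_neg hδ.le]
        have : δ ^ (γ * σ) ≠ 0 := by positivity
        field_simp

end PowerGrowth

/-! ### Sums of reciprocal coefficients -/

/-- Since `(n + 1) ^ k ≤ (n + 1) ⋯ (n + k) = k! * (n + k).choose k`, the negative binomial series
with sum `(1 - ρ) ^ (-(k + 1))` is a majorant. -/
theorem geometric_moment_le (k : ℕ) {ρ : ℝ} (h0 : 0 ≤ ρ) (h1 : ρ < 1) :
    Summable (fun n : ℕ => (((n : ℝ) + 1) * (1 - ρ)) ^ k * ρ ^ n) ∧
      ∑' n : ℕ, (((n : ℝ) + 1) * (1 - ρ)) ^ k * ρ ^ n ≤ k.factorial / (1 - ρ) := by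
  have hδ : 0 < 1 - ρ := by linarith
  have hρ : ‖ρ‖ < 1 := by rwa [Real.norm_of_nonneg h0]
  have hS := (hasSum_choose_mul_geometric_of_norm_lt_one k hρ).mul_left
    ((k.factorial : ℝ) * (1 - ρ) ^ k)
  have hle : ∀ n : ℕ, (((n : ℝ) + 1) * (1 - ρ)) ^ k * ρ ^ n ≤
      (k.factorial : ℝ) * (1 - ρ) ^ k * (((n + k).choose k : ℕ) * ρ ^ n) := by
    intro n
    have h2 : ((n : ℝ) + 1) ^ k ≤ (k.factorial : ℝ) * ((n + k).choose k : ℕ) := by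
      have := Nat.pow_succ_le_ascFactorial (n + 1) k
      rw [Nat.ascFactorial_eq_factorial_mul_choose] at this
      exact_mod_cast this
    calc _ = ((n : ℝ) + 1) ^ k * ((1 - ρ) ^ k * ρ ^ n) := by rw [mul_pow]; ring
      _ ≤ ((k.factorial : ℝ) * ((n + k).choose k : ℕ)) * ((1 - ρ) ^ k * ρ ^ n) := by gcongr
      _ = _ := by ring
  have hnn : ∀ n : ℕ, 0 ≤ (((n : ℝ) + 1) * (1 - ρ)) ^ k * ρ ^ n := fun n => by positivity
  have hsum := Summable.of_nonneg_of_le hnn hle hS.summable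
  refine ⟨hsum, (hsum.tsum_le_tsum hle hS.summable).trans_eq ?_⟩
  rw [hS.tsum_eq, pow_succ]
  field_simp

/-- `∑ ρ ^ n / V (1 / (n + 1))` is at most of the size of its block at `n ≈ 1 / (1 - ρ)`. -/
theorem PowerGrowth.tsum_inv_le {V : ℝ → ℝ} {κ γ : ℝ} {k : ℕ} (h : PowerGrowth V κ γ k) :
    ∃ C : ℝ, 0 ≤ C ∧ ∀ ρ : ℝ, 0 ≤ ρ → ρ < 1 →
      Summable (fun n : ℕ => (V (1 / ((n : ℝ) + 1)))⁻¹ * ρ ^ n) ∧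
      ∑' n : ℕ, (V (1 / ((n : ℝ) + 1)))⁻¹ * ρ ^ n ≤ C / ((1 - ρ) * V (1 - ρ)) := by
  refine ⟨κ * (Nat.factorial 0 + k.factorial), ?_, fun ρ h0 h1 => ?_⟩
  · have := h.one_le; positivity
  have hδ : 0 < 1 - ρ := by linarith
  have hVδ := h.pos _ hδ
  have hκ := h.one_le
  obtain ⟨s0, t0⟩ := geometric_moment_le 0 h0 h1
  obtain ⟨s1, t1⟩ := geometric_moment_le k h0 h1
  have hS := (s0.add s1).mul_left (κ / V (1 - ρ))
  have hle : ∀ n : ℕ, (V (1 / ((n : ℝ) + 1)))⁻¹ * ρ ^ n ≤ κ / V (1 - ρ) *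
      ((((n : ℝ) + 1) * (1 - ρ)) ^ 0 * ρ ^ n + (((n : ℝ) + 1) * (1 - ρ)) ^ k * ρ ^ n) := by
    intro n
    have hN : (0 : ℝ) < n + 1 := by positivity
    have hVN := h.pos (1 / ((n : ℝ) + 1)) (by positivity)
    -- Monotonicity suffices when `1 - ρ ≤ 1 / (n + 1)`. Otherwise the upper exponent costs the
    -- factor `((n + 1)(1 - ρ)) ^ k`. The moments of orders `0` and `k` thus cover both cases.
    have key : V (1 - ρ) ≤ κ * (1 + (((n : ℝ) + 1) * (1 - ρ)) ^ k) * V (1 / ((n : ℝ) + 1)) := by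
      have hp : 0 ≤ (((n : ℝ) + 1) * (1 - ρ)) ^ k := by positivity
      rcases le_total (1 - ρ) (1 / ((n : ℝ) + 1)) with hc | hc
      · have := h.mono hc
        have : 1 * V (1 / ((n : ℝ) + 1)) ≤
          κ * (1 + (((n : ℝ) + 1) * (1 - ρ)) ^ k) * V (1 / ((n : ℝ) + 1)) := by
          gcongr; nlinarith
        linarith
      · refine (h.upper _ _ (by positivity) hc (by linarith)).trans ?_
        have e : (1 - ρ) / (1 / ((n : ℝ) + 1)) = ((n : ℝ) + 1) * (1 - ρ) := by
          field_simp
        rw [e]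
        gcongr
        linarith
    rw [pow_zero, ← add_mul, ← mul_assoc]
    gcongr
    rw [inv_le_iff_one_le_mul₀ hVN, div_mul_eq_mul_div, div_mul_eq_mul_div, le_div_iff₀ hVδ, one_mul]
    exact key
  have hnn : ∀ n : ℕ, 0 ≤ (V (1 / ((n : ℝ) + 1)))⁻¹ * ρ ^ n := fun n => by
    have hVN := h.pos (1 / ((n : ℝ) + 1)) (by positivity)
    positivity
  have hsum := Summable.of_nonneg_of_le hnn hle hS
  refine ⟨hsum, (hsum.tsum_le_tsum hle hS).trans ?_⟩
  rw [tsum_mul_left, s0.tsum_add s1]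
  calc _ ≤ κ / V (1 - ρ) * ((Nat.factorial 0 : ℝ) / (1 - ρ) + k.factorial / (1 - ρ)) := by gcongr
    _ = _ := by field_simp

/-! ### Regular sequences and summation by parts -/

/-- Decreasing sequences whose first two differences are controlled like those of a
Hausdorff moment sequence with the doubling property. -/
structure RegularSequence (m : ℕ → ℝ) (K : ℝ) : Prop where
  pos : ∀ n, 0 < m n
  antitone : ∀ n, m (n + 1) ≤ m n
  doubling : ∀ n, m n ≤ K * m (n + 2)
  diff_le : ∀ n : ℕ, ((n : ℝ) + 1) * (m n - m (n + 1)) ≤ K * m n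
  diff_two_le : ∀ n : ℕ, ((n : ℝ) + 1) ^ 2 * |m n - 2 * m (n + 1) + m (n + 2)| ≤ K * m n

/-- A discrete Leibniz rule for the second difference of `N (N + 1) / M`: each difference falling on
`1 / M` gains a factor `1 / N`, and so does each one falling on the polynomial. The quadratic growth
is therefore cancelled exactly. -/
theorem abs_second_diff_weighted_inv_le {M M₁ M₂ N K : ℝ} (h2 : 0 < M₂) (h12 : M₂ ≤ M₁)
    (h01 : M₁ ≤ M) (hK : M ≤ K * M₂) (hN : 1 ≤ N) (hd : N * (M - M₁) ≤ K * M)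
    (hd1 : (N + 1) * (M₁ - M₂) ≤ K * M₁) (he : N ^ 2 * |M - 2 * M₁ + M₂| ≤ K * M) :
    |(N + 2) * (N + 3) / M₂ - 2 * ((N + 1) * (N + 2) / M₁) + N * (N + 1) / M| ≤
      ((2 * K + 3 * K ^ 2) * K ^ 2 + 4 * K ^ 2 + 2 * K) / M := by
  have h1 : 0 < M₁ := h2.trans_le h12
  have h0 : 0 < M := h1.trans_le h01
  have hK0 : 0 ≤ K := by by_contra! h; nlinarith
  have hK1 : M ≤ K * M₁ := hK.trans (by gcongr)
  -- From `(N + 2)(N + 3) = N (N + 1) + 4 (N + 1) + 2` and `(N + 1)(N + 2) = N (N + 1) + 2 (N + 1)`.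
  -- The first term holds the second difference of `1 / M`, the second its first difference.
  have hid : (N + 2) * (N + 3) / M₂ - 2 * ((N + 1) * (N + 2) / M₁) + N * (N + 1) / M =
      N * (N + 1) * (-(M - 2 * M₁ + M₂) * M + (M - M₁) * ((M - M₁) + (M₁ - M₂))) / (M * M₁ * M₂)
        + 4 * ((N + 1) * (M₁ - M₂)) / (M₁ * M₂) + 2 / M₂ := by
    field_simp; ring
  set e := M - 2 * M₁ + M₂
  set d := M - M₁ with hdd
  set d₁ := M₁ - M₂ with hdd1
  have hd0 : 0 ≤ d := by linarith
  have hd10 : 0 ≤ d₁ := by linarith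
  have hMM : M * M ≤ K ^ 2 * (M₁ * M₂) := by
    calc M * M ≤ (K * M₁) * (K * M₂) := by gcongr
      _ = _ := by ring
  have b1 : |N * (N + 1) * (-e * M + d * (d + d₁)) / (M * M₁ * M₂)| ≤
      (2 * K + 3 * K ^ 2) * K ^ 2 / M := by
    rw [abs_div, abs_of_pos (by positivity : 0 < M * M₁ * M₂), div_le_div_iff₀ (by positivity) h0]
    have hb : |N * (N + 1) * (-e * M + d * (d + d₁))| ≤ (2 * K + 3 * K ^ 2) * (M * M) := by
      rw [abs_mul, abs_of_pos (by positivity : 0 < N * (N + 1))]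
      have t1 : |(-e * M + d * (d + d₁))| ≤ |e| * M + d * (d + d₁) := by
        refine (abs_add_le _ _).trans ?_
        rw [abs_mul, abs_neg, abs_of_pos h0, abs_of_nonneg (by positivity : 0 ≤ d * (d + d₁))]
      have t2 : N * (N + 1) * (|e| * M) ≤ 2 * K * (M * M) := by
        have : N * (N + 1) ≤ 2 * N ^ 2 := by nlinarith
        calc N * (N + 1) * (|e| * M) ≤ 2 * N ^ 2 * (|e| * M) := by gcongr
          _ = 2 * (N ^ 2 * |e|) * M := by ring
          _ ≤ 2 * (K * M) * M := by gcongr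
          _ = _ := by ring
      have t3 : N * (N + 1) * (d * d) ≤ 2 * K ^ 2 * (M * M) := by
        have : N * (N + 1) ≤ 2 * N ^ 2 := by nlinarith
        calc N * (N + 1) * (d * d) ≤ 2 * N ^ 2 * (d * d) := by gcongr
          _ = 2 * ((N * d) * (N * d)) := by ring
          _ ≤ 2 * ((K * M) * (K * M)) := by gcongr
          _ = _ := by ring
      have t4 : N * (N + 1) * (d * d₁) ≤ K ^ 2 * (M * M) := by
        calc N * (N + 1) * (d * d₁) = (N * d) * ((N + 1) * d₁) := by ring
          _ ≤ (K * M) * (K * M₁) := by gcongr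
          _ ≤ (K * M) * (K * M) := by gcongr
          _ = _ := by ring
      calc N * (N + 1) * |(-e * M + d * (d + d₁))|
          ≤ N * (N + 1) * (|e| * M + d * (d + d₁)) := by gcongr
        _ = N * (N + 1) * (|e| * M) + N * (N + 1) * (d * d) + N * (N + 1) * (d * d₁) := by ring
        _ ≤ _ := by linarith
    calc |N * (N + 1) * (-e * M + d * (d + d₁))| * M
        ≤ (2 * K + 3 * K ^ 2) * (M * M) * M := by gcongr
      _ ≤ (2 * K + 3 * K ^ 2) * (K ^ 2 * (M₁ * M₂)) * M := by gcongr
      _ = _ := by ring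
  have b2 : |4 * ((N + 1) * d₁) / (M₁ * M₂)| ≤ 4 * K ^ 2 / M := by
    rw [abs_of_nonneg (by positivity), div_le_div_iff₀ (by positivity) h0]
    calc 4 * ((N + 1) * d₁) * M ≤ 4 * (K * M₁) * (K * M₂) := by gcongr
      _ = _ := by ring
  have b3 : |2 / M₂| ≤ 2 * K / M := by
    rw [abs_of_nonneg (by positivity), div_le_div_iff₀ h2 h0]
    linarith
  rw [hid]
  refine (abs_add_three _ _ _).trans ?_
  rw [add_div, add_div]
  linarith

/-- The power series with coefficients the reciprocals of a sequence. -/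
def recipSeries (m : ℕ → ℝ) (w : ℂ) : ℂ := ∑' n, (((m n)⁻¹ : ℝ) : ℂ) * w ^ n

/-- A second-order derivative of `recipSeries`. -/
def recipSeriesDeriv (m : ℕ → ℝ) (w : ℂ) : ℂ :=
  ∑' n : ℕ, ((((n : ℝ) + 1) * ((n : ℝ) + 2) / m n : ℝ) : ℂ) * w ^ n

theorem summable_poly_mul_geometric {m : ℕ → ℝ} (hpos : ∀ n, 0 < m n) {A : ℝ} {k : ℕ}
    (hA : ∀ n : ℕ, (m n)⁻¹ ≤ A * ((n : ℝ) + 1) ^ k) {ρ : ℝ} (h0 : 0 ≤ ρ) (h1 : ρ < 1) :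
    Summable (fun n : ℕ => (((n : ℝ) + 1) * ((n : ℝ) + 2) / m n) * ρ ^ n) := by
  have hδ : 0 < 1 - ρ := by linarith
  have hA0 : 0 ≤ A := by
    have := hA 0
    have h3 := hpos 0
    simp only [Nat.cast_zero, zero_add, one_pow, mul_one] at this
    exact (by positivity : (0 : ℝ) ≤ (m 0)⁻¹).trans this
  have hS := (geometric_moment_le (k + 2) h0 h1).1.mul_left (2 * A / (1 - ρ) ^ (k + 2))
  refine Summable.of_nonneg_of_le (fun n => ?_) (fun n => ?_) hS
  · have := hpos n; positivity
  · have := hpos n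
    rw [mul_pow]
    calc ((n : ℝ) + 1) * ((n : ℝ) + 2) / m n * ρ ^ n
        ≤ ((n : ℝ) + 1) * (2 * ((n : ℝ) + 1)) * (A * ((n : ℝ) + 1) ^ k) * ρ ^ n := by
          rw [div_eq_mul_inv]
          gcongr
          · linarith
          · exact hA n
      _ = _ := by field_simp; ring

theorem summable_recip_mul_geometric {m : ℕ → ℝ} (hpos : ∀ n, 0 < m n) {A : ℝ} {k : ℕ}
    (hA : ∀ n : ℕ, (m n)⁻¹ ≤ A * ((n : ℝ) + 1) ^ k) {ρ : ℝ} (h0 : 0 ≤ ρ) (h1 : ρ < 1) :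
    Summable (fun n : ℕ => (m n)⁻¹ * ρ ^ n) := by
  refine Summable.of_nonneg_of_le (fun n => ?_) (fun n => ?_)
    (summable_poly_mul_geometric hpos hA h0 h1)
  · have := hpos n; positivity
  · have := hpos n
    gcongr
    rw [inv_eq_one_div]
    gcongr
    nlinarith [(Nat.cast_nonneg n : (0 : ℝ) ≤ n)]

/-- Multiplication by `(1 - w) ^ 2` turns the coefficients into their second differences, which are
of the size of `1 / m n`. This replaces the loss of two powers of `1 - |w|` by two powers of `|1 -
w|`, which are integrable over circles with a better bound. -/
theorem RegularSequence.norm_recipSeriesDeriv_le {m : ℕ → ℝ} {K : ℝ} (h : RegularSequence m K)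
    {A : ℝ} {k : ℕ} (hA : ∀ n : ℕ, (m n)⁻¹ ≤ A * ((n : ℝ) + 1) ^ k) :
    ∃ C : ℝ, 0 ≤ C ∧ ∀ w : ℂ, ‖w‖ < 1 →
      ‖1 - w‖ ^ 2 * ‖recipSeriesDeriv m w‖ ≤ C * ∑' n : ℕ, (m n)⁻¹ * ‖w‖ ^ n := by
  have hK : 0 ≤ K := by
    by_contra! hneg
    nlinarith [h.pos 0, h.pos 2, h.doubling 0]
  set B : ℝ := (2 * K + 3 * K ^ 2) * K ^ 2 + 4 * K ^ 2 + 2 * K with hB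
  have hB0 : 0 ≤ B := by positivity
  -- `B` bounds the second differences. The term `6 * K + 6` pays for the boundary terms `c 0 + c 1
  -- * w - 2 * w * c 0`, where `c 0 = 2 / m 0` and `c 1 = 6 / m 1 ≤ 6 * K / m 0`; the sum on the
  -- right is at least `1 / m 0`.
  refine ⟨B + (6 * K + 6), by positivity, fun w hw => ?_⟩
  set c : ℕ → ℝ := fun n => ((n : ℝ) + 1) * ((n : ℝ) + 2) / m n with hc
  have hsumc : Summable fun n => ((c n : ℝ) : ℂ) * w ^ n := by
    refine Summable.of_norm ?_
    refine (summable_poly_mul_geometric h.pos hA (norm_nonneg w) hw).congr fun n => ?_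
    have := h.pos n
    rw [norm_mul, norm_pow, Complex.norm_real, Real.norm_of_nonneg (by positivity)]
  set S : ℂ := recipSeriesDeriv m w with hS
  have hS0 : HasSum (fun n => ((c n : ℝ) : ℂ) * w ^ n) S := hsumc.hasSum
  have hS1 := (hasSum_nat_add_iff' (f := fun n => ((c n : ℝ) : ℂ) * w ^ n) 1).2 hS0
  have hS2 := (hasSum_nat_add_iff' (f := fun n => ((c n : ℝ) : ℂ) * w ^ n) 2).2 hS0
  have hcomb := (hS2.sub ((hS1.mul_left w).mul_left 2)).add (hS0.mul_left (w ^ 2))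
  simp only [Finset.sum_range_succ, Finset.range_zero, Finset.sum_empty, zero_add, pow_zero,
    mul_one, pow_one] at hcomb
  have hterm : ∀ n : ℕ, ((c (n + 2) : ℝ) : ℂ) * w ^ (n + 2) - 2 * (w * (((c (n + 1) : ℝ) : ℂ) *
      w ^ (n + 1))) + w ^ 2 * (((c n : ℝ) : ℂ) * w ^ n) =
      ((c (n + 2) - 2 * c (n + 1) + c n : ℝ) : ℂ) * w ^ (n + 2) := by
    intro n; push_cast; ring
  simp only [hterm] at hcomb
  have hsa := summable_recip_mul_geometric h.pos hA (norm_nonneg w) hw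
  have hdiff : ∀ n : ℕ, |c (n + 2) - 2 * c (n + 1) + c n| ≤ B * (m n)⁻¹ := by
    intro n
    have := abs_second_diff_weighted_inv_le (N := (n : ℝ) + 1) (h.pos (n + 2)) (h.antitone (n + 1))
      (h.antitone n) (h.doubling n) (by linarith [(Nat.cast_nonneg n : (0 : ℝ) ≤ n)]) (h.diff_le n)
      (by simpa [add_assoc, add_comm, add_left_comm] using h.diff_le (n + 1)) (h.diff_two_le n)
    rw [← hB, div_eq_mul_inv B] at this
    convert this using 2
    simp only [hc]; push_cast; ring
  have hnorm : ‖∑' n, ((c (n + 2) - 2 * c (n + 1) + c n : ℝ) : ℂ) * w ^ (n + 2)‖ ≤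
      B * ∑' n : ℕ, (m n)⁻¹ * ‖w‖ ^ n := by
    rw [← tsum_mul_left]
    refine tsum_of_norm_bounded (hsa.mul_left B).hasSum fun n => ?_
    rw [norm_mul, norm_pow, Complex.norm_real, Real.norm_eq_abs, ← mul_assoc]
    have := h.pos n
    exact mul_le_mul (hdiff n) (pow_le_pow_of_le_one (norm_nonneg w) hw.le (by omega))
      (by positivity) (by positivity)
  rw [hcomb.tsum_eq] at hnorm
  have hzero : (m 0)⁻¹ ≤ ∑' n : ℕ, (m n)⁻¹ * ‖w‖ ^ n := by
    have := hsa.le_tsum 0 fun n _ => by have := h.pos n; positivity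
    simpa using this
  have hm0 := h.pos 0
  have hm1 := h.pos 1
  have hinv1 : (m 1)⁻¹ ≤ K * (m 0)⁻¹ := by
    rw [inv_le_iff_one_le_mul₀ hm1, mul_right_comm, ← div_eq_mul_inv, one_le_div hm0]
    exact (h.doubling 0).trans (by gcongr; exact h.antitone 1)
  have hc0 : c 0 = 2 * (m 0)⁻¹ := by simp only [hc]; norm_num [div_eq_mul_inv]
  have hc1 : c 1 = 6 * (m 1)⁻¹ := by simp only [hc]; norm_num [div_eq_mul_inv]
  have hn0 : ‖((c 0 : ℝ) : ℂ)‖ = 2 * (m 0)⁻¹ := by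
    rw [Complex.norm_real, hc0, Real.norm_of_nonneg (by positivity)]
  have hn1 : ‖((c 1 : ℝ) : ℂ)‖ = 6 * (m 1)⁻¹ := by
    rw [Complex.norm_real, hc1, Real.norm_of_nonneg (by positivity)]
  have hid : (1 - w) ^ 2 * S = (S - (((c 0 : ℝ) : ℂ) + ((c 1 : ℝ) : ℂ) * w) -
      2 * (w * (S - ((c 0 : ℝ) : ℂ))) + w ^ 2 * S) + ((c 0 : ℝ) : ℂ) + ((c 1 : ℝ) : ℂ) * w
        - 2 * (w * ((c 0 : ℝ) : ℂ)) := by ring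
  rw [← norm_pow, ← norm_mul, hid]
  refine (norm_sub_le _ _).trans ?_
  have e1 := norm_add₃_le (a := S - (((c 0 : ℝ) : ℂ) + ((c 1 : ℝ) : ℂ) * w) -
      2 * (w * (S - ((c 0 : ℝ) : ℂ))) + w ^ 2 * S) (b := ((c 0 : ℝ) : ℂ))
      (c := ((c 1 : ℝ) : ℂ) * w)
  have e2 : ‖((c 1 : ℝ) : ℂ) * w‖ ≤ 6 * (m 1)⁻¹ := by
    rw [norm_mul, hn1]; exact mul_le_of_le_one_right (by positivity) hw.le
  have e3 : ‖2 * (w * ((c 0 : ℝ) : ℂ))‖ ≤ 4 * (m 0)⁻¹ := by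
    rw [norm_mul, norm_mul, hn0, Complex.norm_ofNat]
    have : ‖w‖ * (2 * (m 0)⁻¹) ≤ 2 * (m 0)⁻¹ := mul_le_of_le_one_left (by positivity) hw.le
    linarith
  have e4 : (6 * K + 6) * (m 0)⁻¹ ≤ (6 * K + 6) * ∑' n : ℕ, (m n)⁻¹ * ‖w‖ ^ n := by gcongr
  rw [add_mul]
  linarith [hn0.le]

/-! ### Recovering the series from its second-order derivative -/

theorem integral_Ioo_one_sub_mul_pow (n : ℕ) :
    ∫ t in Ioo (0 : ℝ) 1, (1 - t) * t ^ n = 1 / (((n : ℝ) + 1) * ((n : ℝ) + 2)) := by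
  rw [← integral_Ioc_eq_integral_Ioo, ← intervalIntegral.integral_of_le zero_le_one]
  have : (fun t : ℝ => (1 - t) * t ^ n) = fun t => t ^ n - t ^ (n + 1) := by
    ext t; ring
  rw [this, intervalIntegral.integral_sub (by simp) (by simp), integral_pow, integral_pow]
  push_cast
  have h1 : (n : ℝ) + 1 ≠ 0 := by positivity
  have h2 : (n : ℝ) + 2 ≠ 0 := by positivity
  have h3 : (n : ℝ) + 1 + 1 ≠ 0 := by positivity
  simp
  field_simp
  ring

/-- The integral of `(1 - t) t ^ n` over `(0, 1)` is `1 / ((n + 1)(n + 2))`, the inverse of the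
factor in `recipSeriesDeriv`, so termwise integration gives back the series. -/
theorem recipSeries_eq_integral {m : ℕ → ℝ} (hpos : ∀ n, 0 < m n) {A : ℝ} {k : ℕ}
    (hA : ∀ n : ℕ, (m n)⁻¹ ≤ A * ((n : ℝ) + 1) ^ k) {w : ℂ} (hw : ‖w‖ < 1) :
    recipSeries m w = ∫ t in Ioo (0 : ℝ) 1, ((1 - t : ℝ) : ℂ) * recipSeriesDeriv m (t * w) := by
  set c : ℕ → ℝ := fun n => ((n : ℝ) + 1) * ((n : ℝ) + 2) / m n with hc
  have hc0 : ∀ n, 0 ≤ c n := fun n => by have := hpos n; positivity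
  set F : ℕ → ℝ → ℂ := fun n t => (((1 - t) * t ^ n : ℝ) : ℂ) * ((c n : ℂ) * w ^ n) with hF
  have hint : ∀ n, Integrable (F n) (volume.restrict (Ioo (0 : ℝ) 1)) := by
    intro n
    have : Continuous (F n) := by fun_prop
    exact (this.integrableOn_Icc (a := 0) (b := 1)).mono_set Ioo_subset_Icc_self
  have hcm : ∀ n : ℕ, 1 / (((n : ℝ) + 1) * ((n : ℝ) + 2)) * c n = (m n)⁻¹ := by
    intro n
    have := hpos n
    simp only [hc]; field_simp
  have hnormint : ∀ n, ∫ t in Ioo (0 : ℝ) 1, ‖F n t‖ = (m n)⁻¹ * ‖w‖ ^ n := by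
    intro n
    rw [setIntegral_congr_fun (g := fun t => (1 - t) * t ^ n * (c n * ‖w‖ ^ n)) measurableSet_Ioo]
    · rw [integral_mul_const, integral_Ioo_one_sub_mul_pow, ← mul_assoc, hcm]
    · intro t ht
      have h1 : 0 ≤ (1 - t) * t ^ n := mul_nonneg (by linarith [ht.2]) (pow_nonneg ht.1.le n)
      simp only [hF]
      rw [norm_mul, norm_mul, norm_pow, Complex.norm_real, Complex.norm_real,
        Real.norm_of_nonneg h1, Real.norm_of_nonneg (hc0 n)]
  have key := hasSum_integral_of_summable_integral_norm hint
    ((summable_recip_mul_geometric hpos hA (norm_nonneg w) hw).congr fun n => (hnormint n).symm)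
  have hF1 : ∀ n, ∫ t in Ioo (0 : ℝ) 1, F n t = (((m n)⁻¹ : ℝ) : ℂ) * w ^ n := by
    intro n
    simp only [hF]
    rw [integral_mul_const, integral_complex_ofReal, integral_Ioo_one_sub_mul_pow, ← mul_assoc,
      ← Complex.ofReal_mul, hcm]
  simp only [hF1] at key
  rw [recipSeries, key.tsum_eq]
  refine setIntegral_congr_fun measurableSet_Ioo fun t ht => ?_
  simp only [hF, recipSeriesDeriv]
  rw [← tsum_mul_left]
  refine tsum_congr fun n => ?_
  push_cast [hc]
  ring

theorem PowerGrowth.inv_le_pow {V : ℝ → ℝ} {κ γ : ℝ} {k : ℕ} (hV : PowerGrowth V κ γ k) (n : ℕ) :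
    (V (1 / ((n : ℝ) + 1)))⁻¹ ≤ κ / V 1 * ((n : ℝ) + 1) ^ k := by
  have hN : (0 : ℝ) < n + 1 := by positivity
  have h1 := hV.pos 1 one_pos
  have h2 := hV.pos (1 / ((n : ℝ) + 1)) (by positivity)
  have := hV.upper (1 / ((n : ℝ) + 1)) 1 (by positivity)
    (by rw [div_le_one hN]; linarith [(Nat.cast_nonneg n : (0 : ℝ) ≤ n)]) le_rfl
  rw [one_div_one_div] at this
  rw [inv_le_iff_one_le_mul₀ h2, div_mul_eq_mul_div, div_mul_eq_mul_div, le_div_iff₀ h1, one_mul]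
  exact this

/-! ### Size and circular means of the kernel function -/

section Kernel

variable {V : ℝ → ℝ} {κ γ : ℝ} {k : ℕ} {m : ℕ → ℝ} {K A : ℝ}

theorem inv_le_pow_of_inv_le (hV : PowerGrowth V κ γ k) (hA0 : 0 ≤ A)
    (hA : ∀ n : ℕ, (m n)⁻¹ ≤ A * (V (1 / ((n : ℝ) + 1)))⁻¹) (n : ℕ) :
    (m n)⁻¹ ≤ A * (κ / V 1) * ((n : ℝ) + 1) ^ k := by
  refine (hA n).trans ?_
  rw [mul_assoc]
  gcongr
  exact hV.inv_le_pow n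

theorem enorm_recipSeries_le (hV : PowerGrowth V κ γ k) (h : RegularSequence m K) (hA0 : 0 ≤ A)
    (hA : ∀ n : ℕ, (m n)⁻¹ ≤ A * (V (1 / ((n : ℝ) + 1)))⁻¹) :
    ∃ C : ℝ, 0 ≤ C ∧ ∀ w : ℂ, ‖w‖ < 1 → ‖recipSeries m w‖ₑ ≤
      ∫⁻ t in Ioo (0 : ℝ) 1, ENNReal.ofReal (C / V (1 - t * ‖w‖) * (‖1 - t * w‖ ^ 2)⁻¹) := by
  have hA' := inv_le_pow_of_inv_le hV hA0 hA
  obtain ⟨C₁, hC₁, h1⟩ := h.norm_recipSeriesDeriv_le hA'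
  obtain ⟨C₂, hC₂, h2⟩ := hV.tsum_inv_le
  refine ⟨C₁ * (A * C₂), by positivity, fun w hw => ?_⟩
  rw [recipSeries_eq_integral h.pos hA' hw]
  refine (enorm_integral_le_lintegral_enorm _).trans ?_
  refine setLIntegral_mono' measurableSet_Ioo fun t ht => ?_
  have hn : ‖(t : ℂ) * w‖ = t * ‖w‖ := by
    rw [norm_mul, Complex.norm_real, Real.norm_of_nonneg ht.1.le]
  have hρ0 : 0 ≤ t * ‖w‖ := mul_nonneg ht.1.le (norm_nonneg w)
  have hρ1 : t * ‖w‖ < 1 := by nlinarith [ht.1, ht.2, norm_nonneg w]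
  have hρt : t * ‖w‖ ≤ t := mul_le_of_le_one_right ht.1.le hw.le
  set ρ := t * ‖w‖
  have hδ : 0 < 1 - ρ := by linarith
  have hVδ := hV.pos _ hδ
  have hw1 : 0 < ‖1 - (t : ℂ) * w‖ := by
    rw [norm_pos_iff, sub_ne_zero]
    intro he
    rw [← he, norm_one] at hn
    linarith
  have hF := h1 (t * w) (by rw [hn]; exact hρ1)
  rw [hn] at hF
  have hs : ∑' n : ℕ, (m n)⁻¹ * ρ ^ n ≤ A * (C₂ / ((1 - ρ) * V (1 - ρ))) := by
    obtain ⟨s, hs⟩ := h2 ρ hρ0 hρ1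
    calc ∑' n : ℕ, (m n)⁻¹ * ρ ^ n
        ≤ ∑' n : ℕ, A * ((V (1 / ((n : ℝ) + 1)))⁻¹ * ρ ^ n) := by
          refine (summable_recip_mul_geometric h.pos hA' hρ0 hρ1).tsum_le_tsum (fun n => ?_)
            (s.mul_left A)
          rw [← mul_assoc]
          have := hA n
          gcongr
      _ ≤ _ := by rw [tsum_mul_left]; gcongr
  have ht0 : 0 ≤ 1 - t := by linarith [ht.2]
  rw [← ofReal_norm]
  refine ENNReal.ofReal_le_ofReal ?_
  rw [norm_mul, Complex.norm_real, Real.norm_of_nonneg ht0, ← div_eq_mul_inv,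
    le_div_iff₀ (by positivity)]
  -- As `ρ ≤ t`, the weight `1 - t` is at most `1 - ρ` and cancels the same factor in the
  -- denominator.
  calc (1 - t) * ‖recipSeriesDeriv m (t * w)‖ * ‖1 - (t : ℂ) * w‖ ^ 2
      = (1 - t) * (‖1 - (t : ℂ) * w‖ ^ 2 * ‖recipSeriesDeriv m (t * w)‖) := by ring
    _ ≤ (1 - ρ) * (C₁ * (A * (C₂ / ((1 - ρ) * V (1 - ρ))))) := by
        refine mul_le_mul (by linarith) (hF.trans ?_) (by positivity) hδ.le
        gcongr
    _ = _ := by field_simp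

/-- On the unit circle the real part of `(1 + w z) / (1 - w z)` is `(1 - |w|²) / |1 - w z|²`, and
the mean value property gives it mean `1`, its value at `z = 0`. -/
theorem integral_inv_norm_one_sub_sq {w : ℂ} (hw : ‖w‖ < 1) :
    ∫ θ in (0 : ℝ)..(2 * Real.pi), (‖1 - w * circleMap 0 1 θ‖ ^ 2)⁻¹ =
      2 * Real.pi * (1 - ‖w‖ ^ 2)⁻¹ := by
  have hne : ∀ z : ℂ, ‖z‖ ≤ 1 → 1 - w * z ≠ 0 := by
    intro z hz he
    have h1 : ‖w * z‖ = 1 := by rw [← sub_eq_zero.1 he, norm_one]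
    rw [norm_mul] at h1
    nlinarith [norm_nonneg w, norm_nonneg z]
  have hd : DiffContOnCl ℂ (fun z : ℂ => (1 + w * z) / (1 - w * z)) (Metric.ball 0 |(1 : ℝ)|) := by
    refine DifferentiableOn.diffContOnCl ?_
    rw [abs_one, closure_ball _ one_ne_zero]
    intro z hz
    refine DifferentiableAt.differentiableWithinAt ?_
    refine DifferentiableAt.div (by fun_prop) (by fun_prop) (hne z ?_)
    simpa using hz
  have hmean := hd.circleAverage
  have hci : IntervalIntegrable (fun θ => (1 + w * circleMap 0 1 θ) / (1 - w * circleMap 0 1 θ))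
      volume 0 (2 * Real.pi) := by
    refine Continuous.intervalIntegrable ?_ _ _
    refine Continuous.div (by fun_prop) (by fun_prop) fun θ => hne _ (by simp)
  rw [Real.circleAverage_def] at hmean
  have hre := congrArg Complex.re hmean
  rw [Complex.smul_re, ← Complex.reCLM_apply (∫ θ in (0 : ℝ)..(2 * Real.pi), _),
    ← ContinuousLinearMap.intervalIntegral_comp_comm _ hci] at hre
  have hpt : ∀ θ : ℝ, Complex.reCLM ((1 + w * circleMap 0 1 θ) / (1 - w * circleMap 0 1 θ)) =
      (1 - ‖w‖ ^ 2) * (‖1 - w * circleMap 0 1 θ‖ ^ 2)⁻¹ := by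
    intro θ
    set z := circleMap 0 1 θ with hz
    have hnz : ‖w * z‖ ^ 2 = ‖w‖ ^ 2 := by rw [norm_mul]; simp [hz]
    rw [Complex.reCLM_apply, Complex.div_re, ← hnz, ← Complex.normSq_eq_norm_sq,
      ← Complex.normSq_eq_norm_sq, ← add_div, div_eq_mul_inv]
    congr 1
    simp only [Complex.normSq_apply, Complex.add_re, Complex.one_re, Complex.sub_re,
      Complex.add_im, Complex.one_im, Complex.sub_im]
    ring
  simp only [hpt] at hre
  rw [intervalIntegral.integral_const_mul] at hre
  have hpos : 0 < 1 - ‖w‖ ^ 2 := by nlinarith [norm_nonneg w]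
  simp only [smul_eq_mul, mul_zero, add_zero, sub_zero, div_one, Complex.one_re] at hre
  have h2 : (2 * Real.pi) ≠ 0 := by positivity
  field_simp at hre ⊢
  linarith

theorem lintegral_inv_norm_one_sub_sq {w : ℂ} (hw : ‖w‖ < 1) :
    ∫⁻ θ in Ioo (-Real.pi) Real.pi, ENNReal.ofReal ((‖1 - w * circleMap 0 1 θ‖ ^ 2)⁻¹) =
      ENNReal.ofReal (2 * Real.pi * (1 - ‖w‖ ^ 2)⁻¹) := by
  have hcont : Continuous fun θ => (‖1 - w * circleMap 0 1 θ‖ ^ 2)⁻¹ := by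
    refine Continuous.inv₀ (by fun_prop) fun θ he => ?_
    have h1 : w * circleMap 0 1 θ = 1 := by
      have := norm_eq_zero.1 (pow_eq_zero_iff two_ne_zero |>.1 he)
      exact (sub_eq_zero.1 this).symm
    have h2 : ‖w‖ = 1 := by
      have := congrArg norm h1
      simpa using this
    linarith
  rw [← ofReal_integral_eq_lintegral_ofReal]
  · congr 1
    rw [← integral_Ioc_eq_integral_Ioo, ← intervalIntegral.integral_of_le (by linarith [Real.pi_pos]),
      ← integral_inv_norm_one_sub_sq hw]
    have hper : Function.Periodic (fun θ => (‖1 - w * circleMap 0 1 θ‖ ^ 2)⁻¹) (2 * Real.pi) := by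
      intro θ
      simp only [periodic_circleMap 0 1 θ]
    have := hper.intervalIntegral_add_eq (-Real.pi) 0
    rw [zero_add] at this
    rw [← this]
    congr 1
    ring
  · exact (hcont.integrableOn_Icc).mono_set Ioo_subset_Icc_self
  · exact Filter.Eventually.of_forall fun θ => by positivity

theorem setLIntegral_Ioo_one_sub (f : ℝ → ℝ≥0∞) (a b : ℝ) :
    ∫⁻ r in Ioo (1 - b) (1 - a), f r = ∫⁻ u in Ioo a b, f (1 - u) := by
  rw [← lintegral_indicator measurableSet_Ioo, ← lintegral_indicator measurableSet_Ioo,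
    ← lintegral_sub_left_eq_self _ 1]
  refine lintegral_congr fun t => ?_
  by_cases ht : t ∈ Ioo a b
  · have : 1 - t ∈ Ioo (1 - b) (1 - a) := ⟨by linarith [ht.2], by linarith [ht.1]⟩
    simp [ht, this]
  · have : 1 - t ∉ Ioo (1 - b) (1 - a) := fun h => ht ⟨by linarith [h.2], by linarith [h.1]⟩
    simp [ht, this]

/-- With `t = 1 - u`, the quantity `1 - t * ρ` is at least both `1 - ρ` and `u`. The first bound is
used for `u ≤ 1 - ρ`, the second beyond, where the logarithmic integral of `1 / V` applies. -/
theorem PowerGrowth.lintegral_radial_le (hV : PowerGrowth V κ γ k) :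
    ∃ C : ℝ, 0 ≤ C ∧ ∀ ρ : ℝ, 0 ≤ ρ → ρ < 1 →
      ∫⁻ t in Ioo (0 : ℝ) 1, ENNReal.ofReal ((V (1 - t * ρ) * (1 - t * ρ))⁻¹) ≤
        ENNReal.ofReal (C / V (1 - ρ)) := by
  obtain ⟨C, hC, h1⟩ := hV.lintegral_rpow_neg_le one_pos
  refine ⟨1 + C, by positivity, fun ρ h0 hρ => ?_⟩
  have hδ : 0 < 1 - ρ := by linarith
  have hVδ := hV.pos _ hδ
  calc ∫⁻ t in Ioo (0 : ℝ) 1, ENNReal.ofReal ((V (1 - t * ρ) * (1 - t * ρ))⁻¹)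
      = ∫⁻ u in Ioo (0 : ℝ) 1, ENNReal.ofReal ((V (1 - (1 - u) * ρ) * (1 - (1 - u) * ρ))⁻¹) := by
        have := setLIntegral_Ioo_one_sub
          (fun t => ENNReal.ofReal ((V (1 - t * ρ) * (1 - t * ρ))⁻¹)) 0 1
        rwa [sub_self, sub_zero] at this
    _ ≤ ∫⁻ u in Ioc 0 (1 - ρ) ∪ Ioo (1 - ρ) 1,
          ENNReal.ofReal ((V (1 - (1 - u) * ρ) * (1 - (1 - u) * ρ))⁻¹) := by
        refine lintegral_mono_set fun u hu => ?_
        rcases le_or_gt u (1 - ρ) with hc | hc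
        · exact Or.inl ⟨hu.1, hc⟩
        · exact Or.inr ⟨hc, hu.2⟩
    _ ≤ (∫⁻ u in Ioc 0 (1 - ρ),
          ENNReal.ofReal ((V (1 - (1 - u) * ρ) * (1 - (1 - u) * ρ))⁻¹)) +
        ∫⁻ u in Ioo (1 - ρ) 1,
          ENNReal.ofReal ((V (1 - (1 - u) * ρ) * (1 - (1 - u) * ρ))⁻¹) :=
        lintegral_union_le _ _ _
    _ ≤ (∫⁻ u in Ioc 0 (1 - ρ), ENNReal.ofReal ((V (1 - ρ) * (1 - ρ))⁻¹)) +
        ∫⁻ u in Ioo (1 - ρ) 1, ENNReal.ofReal (V u ^ (-(1 : ℝ)) / u) := by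
        refine add_le_add ?_ ?_
        · refine setLIntegral_mono' measurableSet_Ioc fun u hu => ENNReal.ofReal_le_ofReal ?_
          have : 1 - ρ ≤ 1 - (1 - u) * ρ := by nlinarith [hu.1]
          have h3 := hV.mono this
          have h4 := hVδ.trans_le h3
          gcongr
        · refine setLIntegral_mono' measurableSet_Ioo fun u hu => ENNReal.ofReal_le_ofReal ?_
          have hu0 : 0 < u := hδ.trans hu.1
          have hle : u ≤ 1 - (1 - u) * ρ := by nlinarith [hu.2]
          have h2 := hV.mono hle
          have h3 := hV.pos u hu0
          have h4 := h3.trans_le h2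
          rw [Real.rpow_neg_one, div_eq_mul_inv, ← mul_inv]
          gcongr
    _ ≤ ENNReal.ofReal ((V (1 - ρ))⁻¹) + ENNReal.ofReal (C * (V (1 - ρ))⁻¹) := by
        refine add_le_add ?_ ?_
        · rw [setLIntegral_const, Real.volume_Ioc, sub_zero, ← ENNReal.ofReal_mul (by positivity)]
          refine ENNReal.ofReal_le_ofReal (le_of_eq ?_)
          field_simp
        · have := h1 (1 - ρ) hδ
          rwa [Real.rpow_neg_one] at this
    _ = _ := by
        rw [← ENNReal.ofReal_add (by positivity) (by positivity)]
        congr 1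
        field_simp

/-- The circular means of the kernel function are bounded by the reciprocal of `V`. -/
theorem lintegral_circle_recipSeries_le (hV : PowerGrowth V κ γ k) (h : RegularSequence m K)
    (hA0 : 0 ≤ A) (hA : ∀ n : ℕ, (m n)⁻¹ ≤ A * (V (1 / ((n : ℝ) + 1)))⁻¹) :
    ∃ C : ℝ, 0 ≤ C ∧ ∀ w : ℂ, ‖w‖ < 1 →
      ∫⁻ θ in Ioo (-Real.pi) Real.pi, ‖recipSeries m (w * circleMap 0 1 θ)‖ₑ ≤
        ENNReal.ofReal (C / V (1 - ‖w‖)) := by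
  obtain ⟨C₁, hC₁, h1⟩ := enorm_recipSeries_le hV h hA0 hA
  obtain ⟨C₂, hC₂, h2⟩ := hV.lintegral_radial_le
  refine ⟨C₁ * (2 * Real.pi) * C₂, by positivity, fun w hw => ?_⟩
  have hmV : Measurable V := hV.mono.measurable
  have hnw : ∀ θ : ℝ, ‖w * circleMap 0 1 θ‖ = ‖w‖ := fun θ => by simp
  calc ∫⁻ θ in Ioo (-Real.pi) Real.pi, ‖recipSeries m (w * circleMap 0 1 θ)‖ₑ
      ≤ ∫⁻ θ in Ioo (-Real.pi) Real.pi, ∫⁻ t in Ioo (0 : ℝ) 1, ENNReal.ofReal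
          (C₁ / V (1 - t * ‖w‖) * (‖1 - t * (w * circleMap 0 1 θ)‖ ^ 2)⁻¹) := by
        refine lintegral_mono fun θ => ?_
        have := h1 (w * circleMap 0 1 θ) (by rwa [hnw])
        simpa only [hnw] using this
    _ = ∫⁻ t in Ioo (0 : ℝ) 1, ∫⁻ θ in Ioo (-Real.pi) Real.pi, ENNReal.ofReal
          (C₁ / V (1 - t * ‖w‖) * (‖1 - t * (w * circleMap 0 1 θ)‖ ^ 2)⁻¹) := by
        refine lintegral_lintegral_swap (Measurable.aemeasurable ?_)
        have hcm : Measurable (circleMap 0 1) := (continuous_circleMap 0 1).measurable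
        have e1 : Measurable fun p : ℝ × ℝ => circleMap 0 1 p.1 := hcm.comp measurable_fst
        have e2 : Measurable fun p : ℝ × ℝ => (p.2 : ℂ) :=
          Complex.measurable_ofReal.comp measurable_snd
        have e3 : Measurable fun p : ℝ × ℝ => V (1 - p.2 * ‖w‖) :=
          hmV.comp (by fun_prop)
        refine ENNReal.measurable_ofReal.comp ?_
        refine (measurable_const.div e3).mul (Measurable.inv (Measurable.pow_const ?_ 2))
        exact (measurable_const.sub (e2.mul (measurable_const.mul e1))).norm
    _ ≤ ∫⁻ t in Ioo (0 : ℝ) 1, ENNReal.ofReal (C₁ * (2 * Real.pi)) *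
          ENNReal.ofReal ((V (1 - t * ‖w‖) * (1 - t * ‖w‖))⁻¹) := by
        refine setLIntegral_mono' measurableSet_Ioo fun t ht => ?_
        have hn : ‖(t : ℂ) * w‖ = t * ‖w‖ := by
          rw [norm_mul, Complex.norm_real, Real.norm_of_nonneg ht.1.le]
        have hρ0 : 0 ≤ t * ‖w‖ := mul_nonneg ht.1.le (norm_nonneg w)
        have hρ1 : t * ‖w‖ < 1 := by nlinarith [ht.1, ht.2, norm_nonneg w]
        have hδ : 0 < 1 - t * ‖w‖ := by linarith
        have hVδ := hV.pos _ hδ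
        simp only [ENNReal.ofReal_mul (show 0 ≤ C₁ / V (1 - t * ‖w‖) by positivity), ← mul_assoc]
        rw [lintegral_const_mul' _ _ ENNReal.ofReal_ne_top,
          lintegral_inv_norm_one_sub_sq (by rwa [hn]), hn, ← ENNReal.ofReal_mul (by positivity),
          ← ENNReal.ofReal_mul (by positivity)]
        refine ENNReal.ofReal_le_ofReal ?_
        have : (1 - (t * ‖w‖) ^ 2)⁻¹ ≤ (1 - t * ‖w‖)⁻¹ := by
          gcongr; nlinarith
        calc C₁ / V (1 - t * ‖w‖) * (2 * Real.pi * (1 - (t * ‖w‖) ^ 2)⁻¹)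
            ≤ C₁ / V (1 - t * ‖w‖) * (2 * Real.pi * (1 - t * ‖w‖)⁻¹) := by gcongr
          _ = _ := by rw [mul_inv, div_eq_mul_inv]; ring
    _ = ENNReal.ofReal (C₁ * (2 * Real.pi)) * ∫⁻ t in Ioo (0 : ℝ) 1,
          ENNReal.ofReal ((V (1 - t * ‖w‖) * (1 - t * ‖w‖))⁻¹) :=
        lintegral_const_mul' _ _ ENNReal.ofReal_ne_top
    _ ≤ ENNReal.ofReal (C₁ * (2 * Real.pi)) * ENNReal.ofReal (C₂ / V (1 - ‖w‖)) := by
        gcongr; exact h2 _ (norm_nonneg w) hw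
    _ = _ := by
        rw [← ENNReal.ofReal_mul (by positivity), mul_div_assoc]

end Kernel

/-! ### The tail of a regular weight -/

/-- The measure `ω(r) dr` on `(0, 1)`. -/
def lineMeasure (ω : ℂ → ℝ) : Measure ℝ :=
  (volume.restrict (Ioo (0 : ℝ) 1)).withDensity fun r => ENNReal.ofReal (ω (r : ℂ))

/-- The tail integral as a function of the distance to the boundary. -/
def tailMass (ω : ℂ → ℝ) (x : ℝ) : ℝ := (lineMeasure ω).real (Ici (1 - x))

theorem IsDoubling.integrableOn {ω : ℂ → ℝ} (h : IsDoubling ω) :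
    IntegrableOn (fun r : ℝ => ω (r : ℂ)) (Ioo 0 1) :=
  h.2.2.1.1.mono_set Ioo_subset_Ioc_self

theorem IsDoubling.aemeasurable {ω : ℂ → ℝ} (h : IsDoubling ω) :
    AEMeasurable (fun r : ℝ => ENNReal.ofReal (ω (r : ℂ))) (volume.restrict (Ioo (0 : ℝ) 1)) :=
  ENNReal.measurable_ofReal.comp_aemeasurable h.integrableOn.aestronglyMeasurable.aemeasurable

theorem IsDoubling.isFiniteMeasure {ω : ℂ → ℝ} (h : IsDoubling ω) :
    IsFiniteMeasure (lineMeasure ω) :=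
  isFiniteMeasure_withDensity_ofReal h.integrableOn.2

theorem mem_disc_ofReal {r : ℝ} (h0 : 0 ≤ r) (h1 : r < 1) : (r : ℂ) ∈ disc := by
  simpa [disc, abs_of_nonneg h0] using h1

/-- Defining `tailMass` by a measure makes it monotone on the whole line, constant from `1` on; it
is the tail integral only in this range of `x`. -/
theorem IsDoubling.tailMass_eq {ω : ℂ → ℝ} (h : IsDoubling ω) {x : ℝ} (h0 : 0 < x) (h1 : x ≤ 1) :
    tailMass ω x = tail ω (1 - x) := by
  have hset : (Ici (1 - x) ∩ Ioo 0 1 : Set ℝ) =ᵐ[volume] (Ioc (1 - x) 1 : Set ℝ) := by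
    have e : Ioo (1 - x) 1 ⊆ Ici (1 - x) ∩ Ioo 0 1 :=
      fun r hr => ⟨hr.1.le, by linarith [hr.1], hr.2⟩
    have e' : Ici (1 - x) ∩ Ioo 0 1 ⊆ Icc (1 - x) 1 := fun r hr => ⟨hr.1, hr.2.2.le⟩
    refine Filter.EventuallyLE.antisymm ?_ ?_
    · exact e'.eventuallyLE.trans Ioc_ae_eq_Icc.symm.le
    · exact Ioo_ae_eq_Ioc.symm.le.trans e.eventuallyLE
  rw [tailMass, tail, lineMeasure, measureReal_def, withDensity_apply _ measurableSet_Ici,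
    Measure.restrict_restrict measurableSet_Ici, Measure.restrict_congr_set hset,
    ← integral_eq_lintegral_of_nonneg_ae, intervalIntegral.integral_of_le (by linarith)]
  · rw [Filter.EventuallyLE, Measure.restrict_congr_set Ioo_ae_eq_Ioc.symm]
    filter_upwards [ae_restrict_mem measurableSet_Ioo] with r hr
    exact h.1.1 _ (mem_disc_ofReal (by linarith [hr.1]) hr.2)
  · exact (h.2.2.1.1.mono_set (Ioc_subset_Ioc_left (by linarith))).aestronglyMeasurable

theorem IsDoubling.tailMass_mono {ω : ℂ → ℝ} (h : IsDoubling ω) : Monotone (tailMass ω) := by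
  have := h.isFiniteMeasure
  intro x y hxy
  exact measureReal_mono (Ici_subset_Ici.2 (by linarith))

theorem IsDoubling.setLIntegral_lineMeasure {ω : ℂ → ℝ} (h : IsDoubling ω) (f : ℝ → ℝ≥0∞) {a b : ℝ}
    (ha : 0 ≤ a) (hb : b ≤ 1) :
    ∫⁻ r in Ioo (1 - b) (1 - a), f r ∂(lineMeasure ω) =
      ∫⁻ u in Ioo a b, ENNReal.ofReal (ω ((1 - u : ℝ) : ℂ)) * f (1 - u) := by
  have hsub : Ioo (1 - b) (1 - a) ⊆ Ioo 0 1 := Ioo_subset_Ioo (by linarith) (by linarith)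
  rw [← setLIntegral_Ioo_one_sub (fun r => ENNReal.ofReal (ω (r : ℂ)) * f r), lineMeasure,
    setLIntegral_withDensity_eq_setLIntegral_mul_non_measurable₀ _ _ _ measurableSet_Ioo,
    Measure.restrict_restrict measurableSet_Ioo, inter_eq_left.2 hsub]
  · rfl
  · exact Filter.Eventually.of_forall fun _ => ENNReal.ofReal_lt_top
  · exact h.aemeasurable.restrict

/-- The quantitative content of regularity of a nonzero weight. -/
structure RegularTail (ω : ℂ → ℝ) (κ γ : ℝ) (k : ℕ) (B : ℝ) : Prop where
  doubling : IsDoubling ω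
  growth : PowerGrowth (tailMass ω) κ γ k
  bound_nonneg : 0 ≤ B
  weight_le : ∀ u, 0 < u → u ≤ 1 → ω ((1 - u : ℝ) : ℂ) ≤ B * (tailMass ω u / u)

/-- The upper bound on `ω` is kept as it is. The lower bound serves only to give reverse doubling of
the tail. -/
theorem IsRegular.regularTail {ω : ℂ → ℝ} (hω : IsRegular ω) (hω0 : ∃ z ∈ disc, ω z ≠ 0) :
    ∃ κ γ k B, RegularTail ω κ γ k B := by
  obtain ⟨hd, c, B, hc, hB, hcB⟩ := hω
  obtain ⟨D, hD1, hD⟩ := hd.2.2.2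
  have hfin := hd.isFiniteMeasure
  have hmono := hd.tailMass_mono
  have hV := fun x => hd.tailMass_eq (x := x)
  have hnn : ∀ x, 0 ≤ tailMass ω x := fun x => measureReal_nonneg
  have hup : ∀ x, 0 < x → x ≤ 1 → tailMass ω x ≤ D * tailMass ω (x / 2) := by
    intro x h0 h1
    rw [hV x h0 h1, hV (x / 2) (by linarith) (by linarith)]
    have := hD (1 - x) (by linarith) (by linarith)
    rwa [show (1 + (1 - x)) / 2 = 1 - x / 2 by ring] at this
  have hle : ∀ x, 0 < x → x ≤ 1 → ω ((1 - x : ℝ) : ℂ) ≤ B * (tailMass ω x / x) := by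
    intro x h0 h1
    have := (hcB (1 - x) (by linarith) (by linarith)).2
    rwa [← hV x h0 h1, sub_sub_cancel] at this
  have hge : ∀ x, 0 < x → x ≤ 1 → c * (tailMass ω x / x) ≤ ω ((1 - x : ℝ) : ℂ) := by
    intro x h0 h1
    have := (hcB (1 - x) (by linarith) (by linarith)).1
    rwa [← hV x h0 h1, sub_sub_cancel] at this
  -- If the tail vanished at `‖z‖`, the upper bound on `ω` would force `ω z = 0`. Doubling then
  -- carries positivity to every smaller dyadic scale.
  have hpos : ∀ x, 0 < x → 0 < tailMass ω x := by
    obtain ⟨z, hz, hz0⟩ := hω0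
    have hz1 : ‖z‖ < 1 := by simpa [disc] using hz
    have hx0 : 0 < 1 - ‖z‖ := by linarith
    have hx1 : 1 - ‖z‖ ≤ 1 := by linarith [norm_nonneg z]
    set x₀ := 1 - ‖z‖ with hx₀
    have hVx : 0 < tailMass ω x₀ := by
      refine (hnn _).lt_of_ne fun h => hz0 ?_
      have h1 := hle x₀ hx0 hx1
      have h2 := hd.1.1 z hz
      rw [hd.2.1 z hz] at h2 ⊢
      rw [← h, zero_div, mul_zero, hx₀, sub_sub_cancel] at h1
      exact le_antisymm h1 h2
    have hpow : ∀ n : ℕ, 0 < tailMass ω (x₀ / 2 ^ n) := by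
      intro n
      induction n with
      | zero => simpa using hVx
      | succ n ih =>
        have h2 : x₀ / 2 ^ n ≤ 1 := (div_le_self hx0.le (one_le_pow₀ one_le_two)).trans hx1
        have h3 := hup (x₀ / 2 ^ n) (by positivity) h2
        rw [div_div, ← pow_succ] at h3
        by_contra! hneg
        nlinarith
    intro x hx
    obtain ⟨n, hn⟩ := pow_unbounded_of_one_lt (x₀ / x) (one_lt_two (α := ℝ))
    refine (hpow n).trans_le (hmono ?_)
    rw [div_lt_iff₀ hx] at hn
    rw [div_le_iff₀ (by positivity)]
    linarith
  -- For `u` in `(x / 2, x)` the weight at `1 - u` is at least `c * V (x / 2) / x`. This interval of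
  -- length `x / 2` has mass at least `(c / 2) * V (x / 2)`, so `V x ≥ (1 + c / 2) * V (x / 2)`.
  have hlow : ∀ x, 0 < x → x ≤ 1 → tailMass ω (x / 2) ≤ (1 + c / 2)⁻¹ * tailMass ω x := by
    intro x h0 h1
    have hVh := hpos (x / 2) (by linarith)
    rw [inv_mul_eq_div, le_div_iff₀ (by positivity)]
    have hsub : Ioo (1 - x) (1 - x / 2) ∪ Ici (1 - x / 2) ⊆ Ici (1 - x) := by
      rintro r (hr | hr)
      · exact hr.1.le
      · rw [mem_Ici] at hr ⊢; linarith
    have hdisj : Disjoint (Ioo (1 - x) (1 - x / 2)) (Ici (1 - x / 2)) := by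
      rw [disjoint_left]
      intro r hr hr'
      exact absurd hr.2 (not_lt.2 hr')
    have hsum := measureReal_mono (μ := lineMeasure ω) hsub
    rw [measureReal_union hdisj measurableSet_Ici] at hsum
    have hpart : c / 2 * tailMass ω (x / 2) ≤ (lineMeasure ω).real (Ioo (1 - x) (1 - x / 2)) := by
      rw [measureReal_def, ← ENNReal.ofReal_le_iff_le_toReal (measure_ne_top _ _),
        ← setLIntegral_one, hd.setLIntegral_lineMeasure _ (by linarith) h1]
      calc ENNReal.ofReal (c / 2 * tailMass ω (x / 2))
          = ∫⁻ u in Ioo (x / 2) x, ENNReal.ofReal (c * (tailMass ω (x / 2) / x)) := by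
            rw [setLIntegral_const, Real.volume_Ioo, ← ENNReal.ofReal_mul (by positivity)]
            congr 1
            field_simp
            ring
        _ ≤ _ := by
            refine setLIntegral_mono' measurableSet_Ioo fun u hu => ?_
            rw [mul_one]
            have hu0 : 0 < u := by linarith [hu.1]
            refine ENNReal.ofReal_le_ofReal (le_trans ?_ (hge u hu0 (by linarith [hu.2])))
            have := hmono hu.1.le
            have := hu.2.le
            gcongr
            exact hnn u
    calc tailMass ω (x / 2) * (1 + c / 2) = c / 2 * tailMass ω (x / 2) + tailMass ω (x / 2) := by ring
      _ ≤ _ := (add_le_add_left hpart _).trans hsum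
  have hq : (1 + c / 2)⁻¹ < 1 := inv_lt_one_of_one_lt₀ (by linarith)
  obtain ⟨κ, γ, k, hg⟩ := PowerGrowth.of_dyadic hmono hpos hup hq hlow
  exact ⟨κ, γ, k, B, hd, hg, hB.le, hle⟩

/-! ### Polar coordinates -/

theorem lineMeasure_compl (ω : ℂ → ℝ) : lineMeasure ω (Ioo 0 1)ᶜ = 0 := by
  refine withDensity_absolutelyContinuous _ _ ?_
  rw [Measure.restrict_apply measurableSet_Ioo.compl, compl_inter_self, measure_empty]

theorem ae_lineMeasure_mem (ω : ℂ → ℝ) : ∀ᵐ r ∂(lineMeasure ω), r ∈ Ioo (0 : ℝ) 1 :=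
  measure_eq_zero_iff_ae_notMem.1 (lineMeasure_compl ω) |>.mono fun r hr => by simpa using hr

/-- The polar form of `ω dA`. -/
theorem IsDoubling.weightedMeasure_eq_map {ω : ℂ → ℝ} (h : IsDoubling ω) :
    weightedMeasure ω = Measure.map (fun p : ℝ × ℝ => (p.1 : ℂ) * circleMap 0 1 p.2)
      (((lineMeasure ω).withDensity fun r => ENNReal.ofReal (Real.pi⁻¹ * r)).prod
        (volume.restrict (Ioo (-Real.pi) Real.pi))) := by
  have hΦ : Measurable fun p : ℝ × ℝ => (p.1 : ℂ) * circleMap 0 1 p.2 := by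
    refine Continuous.measurable ?_
    fun_prop
  have hmr : Measurable fun r : ℝ => ENNReal.ofReal (Real.pi⁻¹ * r) := by fun_prop
  ext s hs
  have hdisc : MeasurableSet disc := Metric.isOpen_ball.measurableSet
  have hae : AEMeasurable (fun p : ℝ × ℝ => ENNReal.ofReal (ω (p.1 : ℂ)))
      ((volume.restrict (Ioo (0 : ℝ) 1 ×ˢ Ioo (-Real.pi) Real.pi)).restrict
        ((fun p : ℝ × ℝ => (p.1 : ℂ) * circleMap 0 1 p.2) ⁻¹' s)) := by
    refine AEMeasurable.restrict ?_
    rw [Measure.volume_eq_prod, ← Measure.prod_restrict]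
    exact h.aemeasurable.comp_quasiMeasurePreserving Measure.quasiMeasurePreserving_fst
  rw [Measure.map_apply hΦ hs, lineMeasure,
    prod_withDensity_left hmr, prod_withDensity_left₀ h.aemeasurable,
    Measure.prod_restrict, withDensity_apply _ (hΦ hs), ← Measure.volume_eq_prod,
    setLIntegral_withDensity_eq_setLIntegral_mul_non_measurable₀ _ hae _ (hΦ hs)
      (Filter.Eventually.of_forall fun _ => ENNReal.ofReal_lt_top)]
  rw [weightedMeasure, withDensity_apply _ hs, areaMeasure, Measure.restrict_smul,
    lintegral_smul_measure, Measure.restrict_restrict hs, ← lintegral_indicator (hs.inter hdisc),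
    ← Complex.lintegral_comp_polarCoord_symm, Measure.restrict_restrict (hΦ hs), smul_eq_mul,
    ← lintegral_const_mul' _ _ ENNReal.ofReal_ne_top, polarCoord_target,
    ← lintegral_indicator (measurableSet_Ioi.prod measurableSet_Ioo),
    ← lintegral_indicator ((hΦ hs).inter (measurableSet_Ioo.prod measurableSet_Ioo))]
  refine lintegral_congr fun p => ?_
  have hpol : Complex.polarCoord.symm p = (p.1 : ℂ) * circleMap 0 1 p.2 := by
    rw [Complex.polarCoord_symm_apply, circleMap, zero_add, Complex.ofReal_one, one_mul,
      Complex.exp_mul_I, Complex.ofReal_cos, Complex.ofReal_sin]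
  by_cases hp : p ∈ Ioi (0 : ℝ) ×ˢ Ioo (-Real.pi) Real.pi
  · have hp1 : 0 < p.1 := hp.1
    rw [indicator_of_mem hp]
    have hnorm : ‖(p.1 : ℂ) * circleMap 0 1 p.2‖ = p.1 := by
      simp [abs_of_pos hp1]
    by_cases hq : p ∈ (fun p : ℝ × ℝ => (p.1 : ℂ) * circleMap 0 1 p.2) ⁻¹' s ∩
        Ioo (0 : ℝ) 1 ×ˢ Ioo (-Real.pi) Real.pi
    · have hmem : Complex.polarCoord.symm p ∈ s ∩ disc := by
        rw [hpol]
        refine ⟨hq.1, ?_⟩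
        rw [disc, mem_ball_zero_iff, hnorm]
        exact hq.2.1.2
      -- Radiality enters here: `ω` at the point is replaced by `ω` at its modulus.
      rw [indicator_of_mem hq, indicator_of_mem hmem, h.2.1 _ hmem.2, hpol, hnorm, Pi.mul_apply,
        smul_eq_mul, ENNReal.ofReal_mul (by positivity)]
      ring
    · have hmem : Complex.polarCoord.symm p ∉ s ∩ disc := by
        rw [hpol]
        rintro ⟨h1, h2⟩
        rw [disc, mem_ball_zero_iff, hnorm] at h2
        exact hq ⟨h1, ⟨hp1, h2⟩, hp.2⟩
      rw [indicator_of_notMem hq, indicator_of_notMem hmem, smul_zero, mul_zero]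
  · have hq : p ∉ (fun p : ℝ × ℝ => (p.1 : ℂ) * circleMap 0 1 p.2) ⁻¹' s ∩
        Ioo (0 : ℝ) 1 ×ˢ Ioo (-Real.pi) Real.pi := fun hq => hp ⟨hq.2.1.1, hq.2.2⟩
    rw [indicator_of_notMem hp, indicator_of_notMem hq]

theorem IsDoubling.isFiniteMeasure_weightedMeasure {ω : ℂ → ℝ} (h : IsDoubling ω) :
    IsFiniteMeasure (weightedMeasure ω) :=
  isFiniteMeasure_withDensity_ofReal h.1.2.2

theorem ae_weightedMeasure_mem (ω : ℂ → ℝ) : ∀ᵐ z ∂(weightedMeasure ω), z ∈ disc := by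
  refine (withDensity_absolutelyContinuous _ _).ae_le ?_
  refine Measure.ae_smul_measure ?_ _
  exact ae_restrict_mem Metric.isOpen_ball.measurableSet

/-- Integration of nonnegative functions in polar coordinates. -/
theorem IsDoubling.lintegral_weightedMeasure {ω : ℂ → ℝ} (h : IsDoubling ω) {f : ℂ → ℝ≥0∞}
    (hf : Measurable f) :
    ∫⁻ z, f z ∂(weightedMeasure ω) = ∫⁻ r, ENNReal.ofReal (Real.pi⁻¹ * r) *
      (∫⁻ θ in Ioo (-Real.pi) Real.pi, f ((r : ℂ) * circleMap 0 1 θ)) ∂(lineMeasure ω) := by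
  have hΦ : Measurable fun p : ℝ × ℝ => (p.1 : ℂ) * circleMap 0 1 p.2 := by
    refine Continuous.measurable ?_
    fun_prop
  have hmr : Measurable fun r : ℝ => ENNReal.ofReal (Real.pi⁻¹ * r) := by fun_prop
  rw [h.weightedMeasure_eq_map, lintegral_map hf hΦ, lintegral_prod (fun p : ℝ × ℝ => f ((p.1 : ℂ) * circleMap 0 1 p.2))
      (hf.comp hΦ).aemeasurable, lintegral_withDensity_eq_lintegral_mul _ hmr]
  · rfl
  · exact (hf.comp hΦ).lintegral_prod_right'

/-- Integration of integrable functions in polar coordinates. -/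
theorem IsDoubling.integral_weightedMeasure {ω : ℂ → ℝ} (h : IsDoubling ω) {f : ℂ → ℂ}
    (hf : Integrable f (weightedMeasure ω)) :
    ∫ z, f z ∂(weightedMeasure ω) = ∫ r, ((Real.pi⁻¹ * r : ℝ) : ℂ) *
      (∫ θ in Ioo (-Real.pi) Real.pi, f ((r : ℂ) * circleMap 0 1 θ)) ∂(lineMeasure ω) := by
  have hΦ : Measurable fun p : ℝ × ℝ => (p.1 : ℂ) * circleMap 0 1 p.2 := by
    refine Continuous.measurable ?_
    fun_prop
  have hmr : Measurable fun r : ℝ => ENNReal.ofReal (Real.pi⁻¹ * r) := by fun_prop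
  have hfin := h.isFiniteMeasure
  rw [h.weightedMeasure_eq_map] at hf ⊢
  have hfin' : SFinite ((lineMeasure ω).withDensity fun r => ENNReal.ofReal (Real.pi⁻¹ * r)) :=
    inferInstance
  rw [integral_map hΦ.aemeasurable hf.aestronglyMeasurable,
    integral_prod (fun p : ℝ × ℝ => f ((p.1 : ℂ) * circleMap 0 1 p.2)) (hf.comp_measurable hΦ),
    integral_withDensity_eq_integral_toReal_smul hmr (Filter.Eventually.of_forall fun _ => ENNReal.ofReal_lt_top)]
  · refine integral_congr_ae ?_
    filter_upwards [ae_lineMeasure_mem ω] with r hr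
    have : 0 ≤ Real.pi⁻¹ * r := mul_nonneg (by positivity) hr.1.le
    rw [ENNReal.toReal_ofReal this, Complex.real_smul]

theorem lintegral_lineMeasure_eq_Ioo (ω : ℂ → ℝ) (f : ℝ → ℝ≥0∞) :
    ∫⁻ r, f r ∂(lineMeasure ω) = ∫⁻ r in Ioo 0 1, f r ∂(lineMeasure ω) := by
  rw [Measure.restrict_eq_self_of_ae_mem (ae_lineMeasure_mem ω)]

/-! ### Moments of the weight -/

section

variable {ω : ℂ → ℝ} {κ γ B : ℝ} {k : ℕ}

theorem RegularTail.setLIntegral_le (h : RegularTail ω κ γ k B) (f : ℝ → ℝ≥0∞) {a b : ℝ}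
    (ha : 0 ≤ a) (hb : b ≤ 1) :
    ∫⁻ r in Ioo (1 - b) (1 - a), f r ∂(lineMeasure ω) ≤
      ∫⁻ u in Ioo a b, ENNReal.ofReal (B * (tailMass ω u / u)) * f (1 - u) := by
  rw [h.doubling.setLIntegral_lineMeasure f ha hb]
  refine setLIntegral_mono' measurableSet_Ioo fun u hu => ?_
  gcongr
  exact h.weight_le u (ha.trans_lt hu.1) (hu.2.le.trans hb)

/-- Functions concentrated on `1 - r ≲ δ` have integral at most of the size of the tail. -/
theorem RegularTail.lintegral_le (h : RegularTail ω κ γ k B) {g : ℝ → ℝ} {M δ : ℝ} (hM : 0 ≤ M)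
    (h0 : 0 < δ) (h1 : δ ≤ 1) (hg : ∀ r ∈ Ico (0 : ℝ) 1, g r ≤ M)
    (hg' : ∀ r ∈ Ico (0 : ℝ) 1, g r ≤ M * (δ / (1 - r)) ^ (k + 1)) :
    ∫⁻ r, ENNReal.ofReal (g r) ∂(lineMeasure ω) ≤
      ENNReal.ofReal (M * (1 + B * κ) * tailMass ω δ) := by
  have hfin := h.doubling.isFiniteMeasure
  have hB := h.bound_nonneg
  have hκ : 0 < κ := one_pos.trans_le h.growth.one_le
  have hVδ := h.growth.pos δ h0
  have p1 : ∫⁻ r in Ico (1 - δ) 1, ENNReal.ofReal (g r) ∂(lineMeasure ω) ≤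
      ENNReal.ofReal (M * tailMass ω δ) := by
    calc ∫⁻ r in Ico (1 - δ) 1, ENNReal.ofReal (g r) ∂(lineMeasure ω)
        ≤ ∫⁻ r in Ico (1 - δ) 1, ENNReal.ofReal M ∂(lineMeasure ω) := by
          refine setLIntegral_mono' measurableSet_Ico fun r hr => ENNReal.ofReal_le_ofReal ?_
          exact hg r ⟨by linarith [hr.1], hr.2⟩
      _ ≤ ENNReal.ofReal M * lineMeasure ω (Ici (1 - δ)) := by
          rw [setLIntegral_const]
          gcongr
          exact Ico_subset_Ici_self
      _ = _ := by
          rw [ENNReal.ofReal_mul hM, tailMass, measureReal_def, ENNReal.ofReal_toReal (by simp)]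
  -- The growth of `V u / u` is at most of order `u ^ (k - 1)`, so decay of order `k + 1` leaves `u
  -- ^ (-2)`, integrable away from zero. The endpoint `1 - 1` is the form required by
  -- `setLIntegral_le`.
  have p2 : ∫⁻ r in Ioo (1 - 1) (1 - δ), ENNReal.ofReal (g r) ∂(lineMeasure ω) ≤
      ENNReal.ofReal (M * (B * κ) * tailMass ω δ) := by
    calc ∫⁻ r in Ioo (1 - 1) (1 - δ), ENNReal.ofReal (g r) ∂(lineMeasure ω)
        ≤ ∫⁻ u in Ioo δ 1, ENNReal.ofReal (B * (tailMass ω u / u)) *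
            ENNReal.ofReal (g (1 - u)) := h.setLIntegral_le _ h0.le le_rfl
      _ ≤ ∫⁻ u in Ioo δ 1, ENNReal.ofReal (M * (B * κ) * tailMass ω δ * δ) *
            ENNReal.ofReal (u ^ (-(1 : ℝ) - 1)) := by
          refine setLIntegral_mono' measurableSet_Ioo fun u hu => ?_
          have hu0 : 0 < u := h0.trans hu.1
          have hVu := h.growth.pos u hu0
          have hgu := hg' (1 - u) ⟨by linarith [hu.2], by linarith⟩
          rw [sub_sub_cancel] at hgu
          rw [← ENNReal.ofReal_mul (by positivity), ← ENNReal.ofReal_mul (by positivity)]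
          refine ENNReal.ofReal_le_ofReal ?_
          have hup := h.growth.upper δ u h0 hu.1.le hu.2.le
          have e : u ^ (-(1 : ℝ) - 1) = (u ^ 2)⁻¹ := by
            rw [show (-(1 : ℝ) - 1) = -((2 : ℕ) : ℝ) by norm_num, Real.rpow_neg hu0.le,
              Real.rpow_natCast]
          rw [e]
          calc B * (tailMass ω u / u) * g (1 - u)
              ≤ B * (tailMass ω u / u) * (M * (δ / u) ^ (k + 1)) := by gcongr
            _ ≤ B * ((κ * (u / δ) ^ k * tailMass ω δ) / u) * (M * (δ / u) ^ (k + 1)) := by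
                gcongr
            _ = _ := by
                rw [div_pow, div_pow]
                field_simp
                ring
      _ = ENNReal.ofReal (M * (B * κ) * tailMass ω δ * δ) *
            ∫⁻ u in Ioo δ 1, ENNReal.ofReal (u ^ (-(1 : ℝ) - 1)) :=
          lintegral_const_mul' _ _ ENNReal.ofReal_ne_top
      _ ≤ ENNReal.ofReal (M * (B * κ) * tailMass ω δ * δ) *
            ∫⁻ u in Ioi δ, ENNReal.ofReal (u ^ (-(1 : ℝ) - 1)) := by
          gcongr; exact Ioo_subset_Ioi_self
      _ = _ := by
          rw [lintegral_Ioi_rpow one_pos h0, ← ENNReal.ofReal_mul (by positivity),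
            Real.rpow_neg_one]
          congr 1
          field_simp
  calc ∫⁻ r, ENNReal.ofReal (g r) ∂(lineMeasure ω)
      = ∫⁻ r in Ioo 0 1, ENNReal.ofReal (g r) ∂(lineMeasure ω) :=
        lintegral_lineMeasure_eq_Ioo _ _
    _ ≤ ∫⁻ r in Ico (1 - δ) 1 ∪ Ioo (1 - 1) (1 - δ), ENNReal.ofReal (g r) ∂(lineMeasure ω) := by
        refine lintegral_mono_set fun r hr => ?_
        rcases le_or_gt (1 - δ) r with hc | hc
        · exact Or.inl ⟨hc, hr.2⟩
        · exact Or.inr ⟨by linarith [hr.1], hc⟩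
    _ ≤ _ := lintegral_union_le _ _ _
    _ ≤ ENNReal.ofReal (M * tailMass ω δ) + ENNReal.ofReal (M * (B * κ) * tailMass ω δ) :=
        add_le_add p1 p2
    _ = _ := by
        rw [← ENNReal.ofReal_add (by positivity) (by positivity)]
        congr 1
        ring

/-- The moments `∫ 2 r^(2n+1) (1 - r²)^j ω(r) dr`. -/
def betaMoment (ω : ℂ → ℝ) (j n : ℕ) : ℝ :=
  ∫ r, 2 * r ^ (2 * n + 1) * (1 - r ^ 2) ^ j ∂(lineMeasure ω)

/-- The squared norm of `z ^ n` in `A²_ω`. -/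
def moment (ω : ℂ → ℝ) (n : ℕ) : ℝ := betaMoment ω 0 n

theorem integrable_lineMeasure_of_continuous [IsFiniteMeasure (lineMeasure ω)] {g : ℝ → ℝ}
    (hg : Continuous g) : Integrable g (lineMeasure ω) := by
  obtain ⟨C, hC⟩ := isCompact_Icc.exists_bound_of_continuousOn (s := Icc (0 : ℝ) 1) hg.continuousOn
  refine Integrable.of_bound hg.aestronglyMeasurable C ?_
  filter_upwards [ae_lineMeasure_mem ω] with r hr
  exact hC r ⟨hr.1.le, hr.2.le⟩

/-- Differences of moments are again integrals of nonnegative functions, so the conditions on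
differences in `RegularSequence` become size estimates for `betaMoment`. -/
theorem IsDoubling.betaMoment_sub (h : IsDoubling ω) (j n : ℕ) :
    betaMoment ω j n - betaMoment ω j (n + 1) = betaMoment ω (j + 1) n := by
  have := h.isFiniteMeasure
  rw [betaMoment, betaMoment, betaMoment, ← integral_sub]
  · congr 1
    ext r
    ring
  · exact integrable_lineMeasure_of_continuous (by fun_prop)
  · exact integrable_lineMeasure_of_continuous (by fun_prop)

theorem betaMoment_nonneg (ω : ℂ → ℝ) (j n : ℕ) : 0 ≤ betaMoment ω j n := by
  refine integral_nonneg_of_ae ?_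
  filter_upwards [ae_lineMeasure_mem ω] with r hr
  have h0 := hr.1
  have : 0 ≤ 1 - r ^ 2 := by nlinarith [hr.1, hr.2]
  simp only [Pi.zero_apply]
  positivity

theorem pow_mul_exp_neg_le_factorial {y : ℝ} (hy : 0 ≤ y) (i : ℕ) :
    y ^ i * Real.exp (-y) ≤ i.factorial := by
  have := Real.pow_div_factorial_le_exp y hy i
  rw [div_le_iff₀ (by positivity)] at this
  rw [Real.exp_neg, ← div_eq_mul_inv, div_le_iff₀ (Real.exp_pos y)]
  linarith

/-- With `y = (n + 1)(1 - r)`, one has `r ^ (2n + 1) ≤ e * exp (-y)` and `1 - r² ≤ 2 (1 - r)`, and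
`y ^ (j + i) * exp (-y)` is at most `(j + i)!`. The case `i = 0` bounds the integrand uniformly, and
`i = k + 1` gives its decay away from the boundary. -/
theorem beta_integrand_le {r : ℝ} (hr : r ∈ Ico (0 : ℝ) 1) (j n i : ℕ) :
    ((n : ℝ) + 1) ^ j * (2 * r ^ (2 * n + 1) * (1 - r ^ 2) ^ j) * (((n : ℝ) + 1) * (1 - r)) ^ i ≤
      2 * 2 ^ j * Real.exp 1 * (j + i).factorial := by
  set y := ((n : ℝ) + 1) * (1 - r) with hy
  have hr0 := hr.1
  have hu : 0 ≤ 1 - r := by linarith [hr.2]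
  have hy0 : 0 ≤ y := by positivity
  have h1 : r ^ (2 * n + 1) ≤ Real.exp 1 * Real.exp (-y) := by
    calc r ^ (2 * n + 1) ≤ r ^ n := pow_le_pow_of_le_one hr0 hr.2.le (by omega)
      _ ≤ (Real.exp (-(1 - r))) ^ n := by
          gcongr
          linarith [Real.add_one_le_exp (-(1 - r))]
      _ = Real.exp (n * (-(1 - r))) := by rw [← Real.exp_nat_mul]
      _ ≤ Real.exp (1 + -y) := by
          rw [Real.exp_le_exp, hy]; nlinarith
      _ = _ := Real.exp_add _ _
  have h2 : (1 - r ^ 2) ^ j ≤ (2 * (1 - r)) ^ j := by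
    have : 0 ≤ 1 - r ^ 2 := by nlinarith [hr.2]
    gcongr
    nlinarith [hr.2]
  have h3 : 0 ≤ (1 - r ^ 2) ^ j := pow_nonneg (by nlinarith [hr.2]) j
  calc ((n : ℝ) + 1) ^ j * (2 * r ^ (2 * n + 1) * (1 - r ^ 2) ^ j) * y ^ i
      ≤ ((n : ℝ) + 1) ^ j * (2 * (Real.exp 1 * Real.exp (-y)) * (2 * (1 - r)) ^ j) * y ^ i := by
        gcongr
    _ = 2 * 2 ^ j * Real.exp 1 * (y ^ (j + i) * Real.exp (-y)) := by
        rw [pow_add, hy, mul_pow, mul_pow, mul_pow]; ring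
    _ ≤ _ := by
        gcongr
        exact pow_mul_exp_neg_le_factorial hy0 _

theorem RegularTail.betaMoment_le (h : RegularTail ω κ γ k B) (j : ℕ) :
    ∃ C : ℝ, 0 ≤ C ∧ ∀ n : ℕ, ((n : ℝ) + 1) ^ j * betaMoment ω j n ≤
      C * tailMass ω (1 / ((n : ℝ) + 1)) := by
  have hB := h.bound_nonneg
  have hκ : 0 < κ := one_pos.trans_le h.growth.one_le
  set M : ℝ := 2 * 2 ^ j * Real.exp 1 * (j + (k + 1)).factorial with hM
  refine ⟨M * (1 + B * κ), by positivity, fun n => ?_⟩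
  have hN : (0 : ℝ) < (n : ℝ) + 1 := by positivity
  have hVN := h.growth.pos (1 / ((n : ℝ) + 1)) (by positivity)
  rw [betaMoment, ← integral_const_mul]
  have key := h.lintegral_le (M := M) (δ := 1 / ((n : ℝ) + 1))
    (g := fun r => ((n : ℝ) + 1) ^ j * (2 * r ^ (2 * n + 1) * (1 - r ^ 2) ^ j)) (by positivity)
    (by positivity) (by rw [div_le_one hN]; linarith [(Nat.cast_nonneg n : (0 : ℝ) ≤ n)])
    (fun r hr => ?_) (fun r hr => ?_)
  · rw [integral_eq_lintegral_of_nonneg_ae]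
    · exact ENNReal.toReal_le_of_le_ofReal (by positivity) key
    · filter_upwards [ae_lineMeasure_mem ω] with r hr
      have h0 := hr.1
      have : 0 ≤ 1 - r ^ 2 := by nlinarith [hr.1, hr.2]
      simp only [Pi.zero_apply]
      positivity
    · exact Continuous.aestronglyMeasurable (by fun_prop)
  · have := beta_integrand_le hr j n 0
    rw [pow_zero, mul_one] at this
    refine this.trans ?_
    have : j + 0 ≤ j + (k + 1) := by omega
    have := Nat.factorial_le this
    rw [hM]
    gcongr
  · have h1 := beta_integrand_le hr j n (k + 1)
    have hu : 0 < 1 - r := by linarith [hr.2]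
    rw [← hM, ← le_div_iff₀ (by positivity)] at h1
    refine h1.trans_eq ?_
    rw [div_div, one_div, inv_pow, div_eq_mul_inv]

/-- For `1 - r ≤ 1 / (2 (n + 1))` Bernoulli's inequality gives `r ^ (n + 1) ≥ 1 / 2`, so the
integrand is at least `1 / 2` there. The upper exponent passes from this scale to `1 / (n + 1)`. -/
theorem RegularTail.le_moment (h : RegularTail ω κ γ k B) :
    ∃ c : ℝ, 0 < c ∧ ∀ n : ℕ, c * tailMass ω (1 / ((n : ℝ) + 1)) ≤ moment ω n := by
  have hκ : 0 < κ := one_pos.trans_le h.growth.one_le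
  have hfin := h.doubling.isFiniteMeasure
  refine ⟨1 / 2 * (κ * 2 ^ k)⁻¹, by positivity, fun n => ?_⟩
  have hN : (0 : ℝ) < (n : ℝ) + 1 := by positivity
  set N := (n : ℝ) + 1 with hNdef
  have hN1 : 1 ≤ N := by rw [hNdef]; linarith [(Nat.cast_nonneg n : (0 : ℝ) ≤ n)]
  have hV2 := h.growth.pos (1 / (2 * N)) (by positivity)
  have hdoub : tailMass ω (1 / N) ≤ κ * 2 ^ k * tailMass ω (1 / (2 * N)) := by
    have := h.growth.upper (1 / (2 * N)) (1 / N) (by positivity)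
      (one_div_le_one_div_of_le hN (by linarith)) (by rw [div_le_one hN]; exact hN1)
    rwa [show 1 / N / (1 / (2 * N)) = 2 by field_simp] at this
  have hlow : 1 / 2 * tailMass ω (1 / (2 * N)) ≤ moment ω n := by
    rw [moment, betaMoment, tailMass]
    calc 1 / 2 * (lineMeasure ω).real (Ici (1 - 1 / (2 * N)))
        = ∫ r in Ici (1 - 1 / (2 * N)), (1 / 2 : ℝ) ∂(lineMeasure ω) := by
          rw [setIntegral_const, smul_eq_mul, mul_comm]
      _ ≤ ∫ r in Ici (1 - 1 / (2 * N)), 2 * r ^ (2 * n + 1) * (1 - r ^ 2) ^ 0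
            ∂(lineMeasure ω) := by
          refine setIntegral_mono_on (integrable_const _).integrableOn
            (integrable_lineMeasure_of_continuous (by fun_prop)).integrableOn
            measurableSet_Ici fun r hr => ?_
          rw [mem_Ici] at hr
          have hx : 1 / (2 * N) ≤ 1 / 2 := one_div_le_one_div_of_le (by norm_num) (by linarith)
          have hr0 : 1 / 2 ≤ r := by linarith
          have hbern := one_add_mul_le_pow (a := -(1 / (2 * N))) (by linarith) (n + 1)
          have e : 1 + ((n + 1 : ℕ) : ℝ) * -(1 / (2 * N)) = 1 / 2 := by
            push_cast
            rw [← hNdef]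
            field_simp
            ring
          rw [e] at hbern
          have hb : 1 / 2 ≤ r ^ (n + 1) := by
            refine hbern.trans (pow_le_pow_left₀ (by linarith) (by linarith) _)
          -- The half-line `Ici` also contains the null set `r > 1`, where the pointwise bound is
          -- still needed.
          rcases le_or_gt r 1 with hr1 | hr1
          · have h4 : 1 / 4 ≤ r ^ (2 * n + 2) := by
              calc (1 / 4 : ℝ) = 1 / 2 * (1 / 2) := by norm_num
                _ ≤ r ^ (n + 1) * r ^ (n + 1) := by gcongr
                _ = _ := by rw [← pow_add]; congr 1; omega
            have h5 : r ^ (2 * n + 2) ≤ r ^ (2 * n + 1) :=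
              pow_le_pow_of_le_one (by linarith) hr1 (by omega)
            rw [pow_zero]
            linarith
          · have := one_le_pow₀ hr1.le (n := 2 * n + 1)
            rw [pow_zero]
            linarith
      _ ≤ _ := by
          refine setIntegral_le_integral (integrable_lineMeasure_of_continuous (by fun_prop)) ?_
          filter_upwards [ae_lineMeasure_mem ω] with r hr
          have h0 := hr.1
          simp only [Pi.zero_apply]
          positivity
  calc 1 / 2 * (κ * 2 ^ k)⁻¹ * tailMass ω (1 / N)
      ≤ 1 / 2 * (κ * 2 ^ k)⁻¹ * (κ * 2 ^ k * tailMass ω (1 / (2 * N))) := by gcongr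
    _ = 1 / 2 * tailMass ω (1 / (2 * N)) := by field_simp
    _ ≤ _ := hlow

theorem RegularTail.regularSequence (h : RegularTail ω κ γ k B) :
    ∃ K A : ℝ, 0 ≤ A ∧ RegularSequence (moment ω) K ∧
      ∀ n : ℕ, (moment ω n)⁻¹ ≤ A * (tailMass ω (1 / ((n : ℝ) + 1)))⁻¹ := by
  obtain ⟨c, hc, hlow⟩ := h.le_moment
  obtain ⟨C₀, hC₀, h0⟩ := h.betaMoment_le 0
  obtain ⟨C₁, hC₁, h1⟩ := h.betaMoment_le 1
  obtain ⟨C₂, hC₂, h2⟩ := h.betaMoment_le 2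
  have hκ : 0 < κ := one_pos.trans_le h.growth.one_le
  have hV : ∀ n : ℕ, 0 < tailMass ω (1 / ((n : ℝ) + 1)) := fun n =>
    h.growth.pos _ (by positivity)
  have hpos : ∀ n, 0 < moment ω n := fun n => lt_of_lt_of_le (mul_pos hc (hV n)) (hlow n)
  have hsub := h.doubling.betaMoment_sub
  have hVm : ∀ n : ℕ, tailMass ω (1 / ((n : ℝ) + 1)) ≤ c⁻¹ * moment ω n := fun n => by
    rw [inv_mul_eq_div, le_div_iff₀ hc, mul_comm]; exact hlow n
  set K := c⁻¹ * (C₀ * (κ * 3 ^ k) + C₁ + C₂) with hK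
  have hK' : ∀ {D : ℝ} {n : ℕ}, D ≤ C₀ * (κ * 3 ^ k) + C₁ + C₂ → 0 ≤ D →
      D * tailMass ω (1 / ((n : ℝ) + 1)) ≤ K * moment ω n := by
    intro D n hD hD0
    calc D * tailMass ω (1 / ((n : ℝ) + 1)) ≤ D * (c⁻¹ * moment ω n) := by gcongr; exact hVm n
      _ ≤ (C₀ * (κ * 3 ^ k) + C₁ + C₂) * (c⁻¹ * moment ω n) := by
          have := (hpos n).le
          gcongr
      _ = _ := by rw [hK]; ring
  have hp0 : 0 ≤ C₀ * (κ * 3 ^ k) := by positivity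
  refine ⟨K, c⁻¹, by positivity, ⟨hpos, fun n => ?_, fun n => ?_, fun n => ?_, fun n => ?_⟩,
    fun n => ?_⟩
  · have := hsub 0 n
    have h3 := betaMoment_nonneg ω 1 n
    rw [moment, moment]
    linarith
  · have h3 := h0 n
    rw [pow_zero, one_mul] at h3
    have hN : (0 : ℝ) < (n : ℝ) + 1 := by positivity
    have hup : tailMass ω (1 / ((n : ℝ) + 1)) ≤
        κ * 3 ^ k * tailMass ω (1 / (((n + 2 : ℕ) : ℝ) + 1)) := by
      have hV2 := hV (n + 2)
      refine (h.growth.upper (1 / (((n + 2 : ℕ) : ℝ) + 1)) (1 / ((n : ℝ) + 1)) (by positivity)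
        (one_div_le_one_div_of_le hN (by push_cast; linarith)) ?_).trans ?_
      · rw [div_le_one hN]; linarith [(Nat.cast_nonneg n : (0 : ℝ) ≤ n)]
      · gcongr
        -- The ratio of the two scales is `(n + 3) / (n + 1) ≤ 3`.
        rw [div_div_eq_mul_div, div_one, one_div_mul_eq_div, div_le_iff₀ hN]
        push_cast
        linarith [(Nat.cast_nonneg n : (0 : ℝ) ≤ n)]
    calc moment ω n ≤ C₀ * tailMass ω (1 / ((n : ℝ) + 1)) := h3
      _ ≤ C₀ * (κ * 3 ^ k * tailMass ω (1 / (((n + 2 : ℕ) : ℝ) + 1))) := by gcongr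
      _ = C₀ * (κ * 3 ^ k) * tailMass ω (1 / (((n + 2 : ℕ) : ℝ) + 1)) := by ring
      _ ≤ _ := hK' (by linarith) hp0
  · have h3 := h1 n
    rw [pow_one, ← hsub] at h3
    exact h3.trans (hK' (by linarith) hC₁)
  · have h3 := h2 n
    have e : moment ω n - 2 * moment ω (n + 1) + moment ω (n + 2) = betaMoment ω 2 n := by
      rw [← hsub, ← hsub, ← hsub]
      simp only [moment]
      ring
    rw [e, abs_of_nonneg (betaMoment_nonneg ω 2 n)]
    exact h3.trans (hK' (by linarith) hC₂)
  · have := hV n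
    have := hpos n
    rw [← mul_inv]
    gcongr
    exact hlow n

end

/-! ### The reproducing kernel as a power series -/

theorem isOpen_disc : IsOpen disc := Metric.isOpen_ball

theorem mem_disc {z : ℂ} : z ∈ disc ↔ ‖z‖ < 1 := by simp [disc]

theorem differentiableOn_tsum_pow {a : ℕ → ℂ}
    (ha : ∀ ρ : ℝ, 0 ≤ ρ → ρ < 1 → Summable fun n => ‖a n‖ * ρ ^ n) :
    DifferentiableOn ℂ (fun z => ∑' n, a n * z ^ n) disc := by
  intro z hz
  rw [mem_disc] at hz
  obtain ⟨ρ, h1, h2⟩ := exists_between hz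
  have hd : DifferentiableOn ℂ (fun z => ∑' n, a n * z ^ n) (Metric.ball 0 ρ) := by
    refine Complex.differentiableOn_tsum_of_summable_norm (ha ρ ((norm_nonneg z).trans h1.le) h2)
      (fun n => by fun_prop) Metric.isOpen_ball fun n w hw => ?_
    rw [mem_ball_zero_iff] at hw
    rw [norm_mul, norm_pow]
    gcongr
  exact (hd.differentiableAt (Metric.isOpen_ball.mem_nhds (by simpa using h1))).differentiableWithinAt

theorem aestronglyMeasurable_weightedMeasure {ω : ℂ → ℝ} {f : ℂ → ℂ} (hf : ContinuousOn f disc) :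
    AEStronglyMeasurable f (weightedMeasure ω) := by
  rw [← Measure.restrict_eq_self_of_ae_mem (ae_weightedMeasure_mem ω)]
  exact hf.aestronglyMeasurable isOpen_disc.measurableSet

/-- Cauchy's formula for Taylor coefficients, on circles centred at the origin. -/
theorem integral_Ioo_mul_conj_pow {f : ℂ → ℂ} (hf : DifferentiableOn ℂ f disc) {r : ℝ}
    (hr : r ∈ Ioo (0 : ℝ) 1) (n : ℕ) :
    ∫ θ in Ioo (-Real.pi) Real.pi, f ((r : ℂ) * circleMap 0 1 θ) *
        conj ((r : ℂ) * circleMap 0 1 θ) ^ n =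
      2 * Real.pi * r ^ (2 * n) * (iteratedDeriv n f 0 / n.factorial) := by
  have hr0 : (r : ℂ) ≠ 0 := by exact_mod_cast hr.1.ne'
  have hcm : ∀ θ, (r : ℂ) * circleMap 0 1 θ = circleMap 0 r θ := fun θ => by simp [circleMap]
  have hc := (hf.mono (s := Metric.closedBall 0 r) fun z hz => by
    rw [mem_disc]; exact (mem_closedBall_zero_iff.1 hz).trans_lt
      hr.2).circleIntegral_one_div_sub_center_pow_smul hr.1 n
  have hper : Function.Periodic (fun θ => f (circleMap 0 r θ) * conj (circleMap 0 r θ) ^ n)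
      (2 * Real.pi) := by
    intro θ
    simp only [periodic_circleMap 0 r θ]
  have hshift := hper.intervalIntegral_add_eq (-Real.pi) 0
  rw [zero_add, show -Real.pi + 2 * Real.pi = Real.pi by ring] at hshift
  simp only [hcm]
  rw [← integral_Ioc_eq_integral_Ioo, ← intervalIntegral.integral_of_le (by linarith [Real.pi_pos]),
    hshift]
  have hpt : ∀ θ : ℝ, deriv (circleMap 0 r) θ • ((1 / (circleMap 0 r θ - 0) ^ (n + 1)) •
      f (circleMap 0 r θ)) =
      (Complex.I / r ^ (2 * n)) * (f (circleMap 0 r θ) * conj (circleMap 0 r θ) ^ n) := by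
    intro θ
    have hne : circleMap 0 r θ ≠ 0 := by
      have : ‖circleMap 0 r θ‖ = |r| := by simp
      rw [← norm_pos_iff, this]
      exact abs_pos.2 hr.1.ne'
    -- On the circle of radius `r` conjugation is `ζ ↦ r² / ζ`, which turns the pairing with `conj ζ
    -- ^ n` into Cauchy's coefficient integral.
    have hconj : conj (circleMap 0 r θ) = r ^ 2 / circleMap 0 r θ := by
      rw [eq_div_iff hne, mul_comm, Complex.mul_conj, Complex.normSq_eq_norm_sq, norm_circleMap_zero,
        sq_abs]
      push_cast
      rfl
    rw [hconj, deriv_circleMap, sub_zero, smul_eq_mul, smul_eq_mul, div_pow, ← pow_mul]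
    field_simp
    ring
  rw [circleIntegral] at hc
  simp only [hpt] at hc
  rw [intervalIntegral.integral_const_mul, smul_eq_mul] at hc
  have hfac : (n.factorial : ℂ) ≠ 0 := by exact_mod_cast n.factorial_ne_zero
  have hI := Complex.I_ne_zero
  field_simp at hc ⊢
  linear_combination hc

section

variable {ω : ℂ → ℝ} {κ γ B : ℝ} {k : ℕ}

theorem integrable_mul_conj_pow {f : ℂ → ℂ} (hf : Integrable f (weightedMeasure ω)) (n : ℕ) :
    Integrable (fun ζ => f ζ * conj ζ ^ n) (weightedMeasure ω) := by
  refine hf.mul_bdd (c := 1) (aestronglyMeasurable_weightedMeasure ?_) ?_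
  · exact Continuous.continuousOn (by fun_prop)
  · filter_upwards [ae_weightedMeasure_mem ω] with ζ hζ
    rw [mem_disc] at hζ
    rw [norm_pow, RCLike.norm_conj]
    exact pow_le_one₀ (norm_nonneg _) hζ.le

theorem norm_integral_mul_conj_pow_le {f : ℂ → ℂ} (hf : Integrable f (weightedMeasure ω)) (n : ℕ) :
    ∫ ζ, ‖f ζ * conj ζ ^ n‖ ∂(weightedMeasure ω) ≤ ∫ ζ, ‖f ζ‖ ∂(weightedMeasure ω) := by
  refine integral_mono_ae (integrable_mul_conj_pow hf n).norm hf.norm ?_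
  filter_upwards [ae_weightedMeasure_mem ω] with ζ hζ
  rw [mem_disc] at hζ
  rw [norm_mul, norm_pow, RCLike.norm_conj]
  exact mul_le_of_le_one_right (norm_nonneg _) (pow_le_one₀ (norm_nonneg _) hζ.le)

/-- Pairing an analytic function with a monomial gives the Taylor coefficient times the moment. -/
theorem IsDoubling.integral_mul_conj_pow (h : IsDoubling ω) {f : ℂ → ℂ}
    (hf : DifferentiableOn ℂ f disc) (hfi : Integrable f (weightedMeasure ω)) (n : ℕ) :
    ∫ ζ, f ζ * conj ζ ^ n ∂(weightedMeasure ω) =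
      iteratedDeriv n f 0 / n.factorial * moment ω n := by
  rw [h.integral_weightedMeasure (integrable_mul_conj_pow hfi n), moment, betaMoment,
    ← integral_complex_ofReal, ← integral_const_mul]
  refine integral_congr_ae ?_
  filter_upwards [ae_lineMeasure_mem ω] with r hr
  rw [integral_Ioo_mul_conj_pow hf hr]
  have hpi : (Real.pi : ℂ) ≠ 0 := by exact_mod_cast Real.pi_ne_zero
  push_cast
  field_simp
  ring

/-- The explicit Bergman kernel. -/
def kernelFun (ω : ℂ → ℝ) (z ζ : ℂ) : ℂ := recipSeries (moment ω) (conj z * ζ)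

theorem RegularTail.moment_pos (h : RegularTail ω κ γ k B) (n : ℕ) : 0 < moment ω n := by
  obtain ⟨K, A, hA0, hm, hA⟩ := h.regularSequence
  exact hm.pos n

theorem RegularTail.summable_inv_moment (h : RegularTail ω κ γ k B) {ρ : ℝ} (h0 : 0 ≤ ρ)
    (h1 : ρ < 1) : Summable fun n => (moment ω n)⁻¹ * ρ ^ n := by
  obtain ⟨K, A, hA0, hm, hA⟩ := h.regularSequence
  exact summable_recip_mul_geometric hm.pos (inv_le_pow_of_inv_le h.growth hA0 hA) h0 h1

theorem RegularTail.norm_inv_moment (h : RegularTail ω κ γ k B) (n : ℕ) :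
    ‖(((moment ω n)⁻¹ : ℝ) : ℂ)‖ = (moment ω n)⁻¹ := by
  have := h.moment_pos n
  rw [Complex.norm_real, Real.norm_of_nonneg (by positivity)]

theorem RegularTail.differentiableOn_recipSeries (h : RegularTail ω κ γ k B) :
    DifferentiableOn ℂ (recipSeries (moment ω)) disc := by
  refine differentiableOn_tsum_pow fun ρ h0 h1 => ?_
  simpa only [h.norm_inv_moment] using h.summable_inv_moment h0 h1

theorem conj_mul_mem_disc {z ζ : ℂ} (hz : z ∈ disc) (hζ : ζ ∈ disc) : conj z * ζ ∈ disc := by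
  rw [mem_disc] at *
  rw [norm_mul, RCLike.norm_conj]
  nlinarith [norm_nonneg z, norm_nonneg ζ]

theorem RegularTail.differentiableOn_kernelFun (h : RegularTail ω κ γ k B) {z : ℂ} (hz : z ∈ disc) :
    DifferentiableOn ℂ (kernelFun ω z) disc :=
  h.differentiableOn_recipSeries.comp (by fun_prop) fun _ hζ => conj_mul_mem_disc hz hζ

theorem RegularTail.norm_kernelFun_le (h : RegularTail ω κ γ k B) {z ζ : ℂ} (hz : z ∈ disc)
    (hζ : ζ ∈ disc) : ‖kernelFun ω z ζ‖ ≤ ∑' n, (moment ω n)⁻¹ * ‖z‖ ^ n := by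
  rw [mem_disc] at hz hζ
  refine tsum_of_norm_bounded (h.summable_inv_moment (norm_nonneg z) hz).hasSum fun n => ?_
  have := h.moment_pos n
  rw [norm_mul, h.norm_inv_moment, norm_pow, norm_mul, RCLike.norm_conj]
  gcongr
  exact mul_le_of_le_one_right (norm_nonneg _) hζ.le

theorem conj_kernelFun (z ζ : ℂ) :
    conj (kernelFun ω z ζ) = ∑' n, (((moment ω n)⁻¹ : ℝ) : ℂ) * z ^ n * conj ζ ^ n := by
  rw [kernelFun, recipSeries, Complex.conj_tsum]
  refine tsum_congr fun n => ?_
  rw [map_mul, map_pow, map_mul, Complex.conj_conj, Complex.conj_ofReal, mul_pow, mul_assoc]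

theorem RegularTail.memBergman_kernelFun (h : RegularTail ω κ γ k B) {z : ℂ} (hz : z ∈ disc)
    (p : ℝ≥0∞) : MemBergman ω p (kernelFun ω z) := by
  have := h.doubling.isFiniteMeasure_weightedMeasure
  refine ⟨h.differentiableOn_kernelFun hz, MemLp.of_bound (aestronglyMeasurable_weightedMeasure
    (h.differentiableOn_kernelFun hz).continuousOn) (∑' n, (moment ω n)⁻¹ * ‖z‖ ^ n) ?_⟩
  filter_upwards [ae_weightedMeasure_mem ω] with ζ hζ
  exact h.norm_kernelFun_le hz hζ

theorem RegularTail.integrable_mul_kernelFun (h : RegularTail ω κ γ k B) {z : ℂ} (hz : z ∈ disc)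
    {f : ℂ → ℂ} (hf : Integrable f (weightedMeasure ω)) :
    Integrable (fun ζ => f ζ * conj (kernelFun ω z ζ)) (weightedMeasure ω) := by
  refine hf.mul_bdd (c := ∑' n, (moment ω n)⁻¹ * ‖z‖ ^ n) ?_ ?_
  · exact (Complex.continuous_conj.comp_aestronglyMeasurable
      (h.memBergman_kernelFun hz 2).2.aestronglyMeasurable)
  · filter_upwards [ae_weightedMeasure_mem ω] with ζ hζ
    rw [RCLike.norm_conj]
    exact h.norm_kernelFun_le hz hζ

/-- Used twice: for analytic `f` the sum is the Taylor series, which proves the reproducing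
property; for general `f` it shows that the projection is analytic. -/
theorem RegularTail.hasSum_integral_kernelFun (h : RegularTail ω κ γ k B) {z : ℂ} (hz : z ∈ disc)
    {f : ℂ → ℂ} (hf : Integrable f (weightedMeasure ω)) :
    HasSum (fun n => (((moment ω n)⁻¹ : ℝ) : ℂ) * (∫ ζ, f ζ * conj ζ ^ n ∂(weightedMeasure ω)) *
      z ^ n) (∫ ζ, f ζ * conj (kernelFun ω z ζ) ∂(weightedMeasure ω)) := by
  have hz' := mem_disc.1 hz
  set a : ℕ → ℂ := fun n => (((moment ω n)⁻¹ : ℝ) : ℂ) * z ^ n with ha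
  have hna : ∀ n, ‖a n‖ = (moment ω n)⁻¹ * ‖z‖ ^ n := fun n => by
    rw [ha, norm_mul, h.norm_inv_moment, norm_pow]
  have key := hasSum_integral_of_summable_integral_norm
    (F := fun n ζ => a n * (f ζ * conj ζ ^ n)) (μ := weightedMeasure ω)
    (fun n => (integrable_mul_conj_pow hf n).const_mul _) ?_
  · have e1 : ∫ ζ, f ζ * conj (kernelFun ω z ζ) ∂(weightedMeasure ω) =
        ∫ ζ, ∑' n, a n * (f ζ * conj ζ ^ n) ∂(weightedMeasure ω) := by
      refine integral_congr_ae (Filter.Eventually.of_forall fun ζ => ?_)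
      simp only
      rw [conj_kernelFun, ← tsum_mul_left]
      refine tsum_congr fun n => ?_
      rw [ha]
      ring
    rw [e1]
    refine key.congr_fun fun n => ?_
    rw [integral_const_mul, ha]
    ring
  · refine Summable.of_nonneg_of_le (fun n => integral_nonneg fun _ => norm_nonneg _) (fun n => ?_)
      ((h.summable_inv_moment (norm_nonneg z) hz').mul_right (∫ ζ, ‖f ζ‖ ∂(weightedMeasure ω)))
    have := norm_integral_mul_conj_pow_le hf n
    have h2 : ∀ ζ, ‖a n * (f ζ * conj ζ ^ n)‖ = ‖a n‖ * ‖f ζ * conj ζ ^ n‖ :=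
      fun ζ => norm_mul _ _
    simp only [h2]
    rw [integral_const_mul, ← hna]
    gcongr

theorem RegularTail.isReproducingKernelAt (h : RegularTail ω κ γ k B) {z : ℂ} (hz : z ∈ disc) :
    IsReproducingKernelAt ω z (kernelFun ω z) := by
  have := h.doubling.isFiniteMeasure_weightedMeasure
  refine ⟨h.memBergman_kernelFun hz 2, fun f hf => ?_⟩
  have hfi : Integrable f (weightedMeasure ω) := hf.2.integrable (by norm_num)
  have h1 := h.hasSum_integral_kernelFun hz hfi
  have h2 := Complex.hasSum_taylorSeries_on_ball hf.1 hz
  refine h2.unique (h1.congr_fun ?_)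
  intro n
  rw [h.doubling.integral_mul_conj_pow hf.1 hfi]
  have hm : ((moment ω n : ℝ) : ℂ) ≠ 0 := by exact_mod_cast (h.moment_pos n).ne'
  have hfac : (n.factorial : ℂ) ≠ 0 := by exact_mod_cast n.factorial_ne_zero
  rw [sub_zero, smul_eq_mul, smul_eq_mul]
  push_cast
  field_simp

/-- The difference of two kernels lies in `A²_ω`, and both kernels reproduce it, so its pairing with
itself is zero. Equality almost everywhere is enough to replace the chosen `bergmanKernel` by
`kernelFun` under integrals. -/
theorem IsReproducingKernelAt.ae_eq {z : ℂ} {K K' : ℂ → ℂ} (h : IsReproducingKernelAt ω z K)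
    (h' : IsReproducingKernelAt ω z K') : K =ᵐ[weightedMeasure ω] K' := by
  have hint : ∀ {f g : ℂ → ℂ}, MemLp f 2 (weightedMeasure ω) → MemLp g 2 (weightedMeasure ω) →
      Integrable (fun ζ => f ζ * conj (g ζ)) (weightedMeasure ω) :=
    fun hf hg => hf.integrable_mul hg.star
  set g : ℂ → ℂ := fun ζ => K ζ - K' ζ with hg
  have hgB : MemBergman ω 2 g := ⟨h.1.1.sub h'.1.1, h.1.2.sub h'.1.2⟩
  have h0 : ∫ ζ, g ζ * conj (g ζ) ∂(weightedMeasure ω) = 0 := by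
    have e : ∀ ζ, g ζ * conj (g ζ) = g ζ * conj (K ζ) - g ζ * conj (K' ζ) := fun ζ => by
      simp only [hg, map_sub]; ring
    simp only [e]
    rw [integral_sub (hint hgB.2 h.1.2) (hint hgB.2 h'.1.2), ← h.2 g hgB, ← h'.2 g hgB, sub_self]
  have hsq : ∀ ζ, g ζ * conj (g ζ) = ((‖g ζ‖ ^ 2 : ℝ) : ℂ) := fun ζ => by
    rw [Complex.mul_conj, Complex.normSq_eq_norm_sq]
  have hi := hint hgB.2 hgB.2
  simp only [hsq] at h0 hi
  rw [integral_complex_ofReal] at h0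
  have hz := (integral_eq_zero_iff_of_nonneg (fun ζ => by positivity) (by simpa only [RCLike.re_eq_complex_re, Complex.ofReal_re] using hi.re)).1
    (Complex.ofReal_eq_zero.1 h0)
  filter_upwards [hz] with ζ hζ
  have : ‖g ζ‖ = 0 := by simpa using hζ
  exact sub_eq_zero.1 (norm_eq_zero.1 this)

theorem RegularTail.isReproducingKernelAt_bergmanKernel (h : RegularTail ω κ γ k B) {z : ℂ}
    (hz : z ∈ disc) : IsReproducingKernelAt ω z (bergmanKernel ω z) :=
  Classical.epsilon_spec (p := fun K : ℂ → ℂ => IsReproducingKernelAt ω z K)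
    ⟨_, h.isReproducingKernelAt hz⟩

theorem RegularTail.bergmanKernel_ae_eq (h : RegularTail ω κ γ k B) {z : ℂ} (hz : z ∈ disc) :
    bergmanKernel ω z =ᵐ[weightedMeasure ω] kernelFun ω z :=
  (h.isReproducingKernelAt_bergmanKernel hz).ae_eq (h.isReproducingKernelAt hz)

end

/-! ### Schur's test -/

/-- Schur's test for a nonnegative kernel. -/
theorem lintegral_rpow_lintegral_mul_le_of_schur {α : Type*} [MeasurableSpace α] {μ : Measure α}
    [SFinite μ] {K : α → α → ℝ≥0∞} (hK : Measurable (Function.uncurry K)) {h : α → ℝ≥0∞}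
    (hm : Measurable h) (hpos : ∀ᵐ x ∂μ, h x ≠ 0) (hfin : ∀ᵐ x ∂μ, h x ≠ ∞) {p q : ℝ}
    (hpq : p.HolderConjugate q) {C : ℝ≥0∞}
    (h1 : ∀ᵐ x ∂μ, ∫⁻ y, K x y * h y ^ q ∂μ ≤ C * h x ^ q)
    (h2 : ∀ᵐ y ∂μ, ∫⁻ x, K x y * h x ^ p ∂μ ≤ C * h y ^ p) {f : α → ℝ≥0∞} (hf : Measurable f) :
    ∫⁻ x, (∫⁻ y, K x y * f y ∂μ) ^ p ∂μ ≤ C ^ p * ∫⁻ y, f y ^ p ∂μ := by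
  have hp : 0 < p := hpq.pos
  have hq : 0 < q := hpq.symm.pos
  have hKx : ∀ x, Measurable (K x) := fun x => hK.comp measurable_prodMk_left
  have hKy : ∀ y, Measurable fun x => K x y := fun y => hK.comp measurable_prodMk_right
  set g : α → ℝ≥0∞ := fun y => (h y ^ p)⁻¹ * f y ^ p with hg
  have hgm : Measurable g := (hm.pow_const p).inv.mul (hf.pow_const p)
  -- Hölder's inequality after splitting `K * f` as `(K ^ (1/q) * h) * (K ^ (1/p) * h⁻¹ * f)`; the
  -- first factor is controlled by `h1`.
  have hpoint : ∀ᵐ x ∂μ, (∫⁻ y, K x y * f y ∂μ) ^ p ≤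
      C ^ (p / q) * (h x ^ p * ∫⁻ y, K x y * g y ∂μ) := by
    filter_upwards [h1] with x hx
    have hold := ENNReal.lintegral_mul_le_Lp_mul_Lq μ hpq.symm
      (f := fun y => K x y ^ (1 / q) * h y) (g := fun y => K x y ^ (1 / p) * ((h y)⁻¹ * f y))
      (((hKx x).pow_const _).mul hm).aemeasurable
      (((hKx x).pow_const _).mul (hm.inv.mul hf)).aemeasurable
    have e0 : ∫⁻ y, K x y * f y ∂μ = ∫⁻ y, ((fun y => K x y ^ (1 / q) * h y) *
        fun y => K x y ^ (1 / p) * ((h y)⁻¹ * f y)) y ∂μ := by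
      refine lintegral_congr_ae ?_
      filter_upwards [hpos, hfin] with y hy0 hy1
      rw [Pi.mul_apply]
      calc K x y * f y = K x y ^ (1 / q + 1 / p) * (h y * (h y)⁻¹) * f y := by
            rw [ENNReal.mul_inv_cancel hy0 hy1, one_div, one_div, add_comm,
              hpq.inv_add_inv_eq_one, ENNReal.rpow_one, mul_one]
        _ = _ := by
            rw [ENNReal.rpow_add_of_nonneg _ _ (by positivity) (by positivity)]; ring
    have e1 : ∫⁻ y, (K x y ^ (1 / q) * h y) ^ q ∂μ = ∫⁻ y, K x y * h y ^ q ∂μ := by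
      refine lintegral_congr fun y => ?_
      rw [ENNReal.mul_rpow_of_nonneg _ _ hq.le, ← ENNReal.rpow_mul, one_div_mul_cancel hq.ne',
        ENNReal.rpow_one]
    have e2 : ∫⁻ y, (K x y ^ (1 / p) * ((h y)⁻¹ * f y)) ^ p ∂μ = ∫⁻ y, K x y * g y ∂μ := by
      refine lintegral_congr fun y => ?_
      rw [ENNReal.mul_rpow_of_nonneg _ _ hp.le, ENNReal.mul_rpow_of_nonneg _ _ hp.le,
        ← ENNReal.rpow_mul, one_div_mul_cancel hp.ne', ENNReal.rpow_one, ENNReal.inv_rpow]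
    rw [← e0, e1, e2] at hold
    calc (∫⁻ y, K x y * f y ∂μ) ^ p
        ≤ ((C * h x ^ q) ^ (1 / q) * (∫⁻ y, K x y * g y ∂μ) ^ (1 / p)) ^ p := by
          gcongr
          exact hold.trans (by gcongr)
      _ = _ := by
          have x1 : (C * h x ^ q) ^ (1 / q * p) = C ^ (p / q) * h x ^ p := by
            rw [ENNReal.mul_rpow_of_nonneg _ _ (by positivity), ← ENNReal.rpow_mul,
              show 1 / q * p = p / q by ring, show q * (p / q) = p by field_simp]
          rw [ENNReal.mul_rpow_of_nonneg _ _ hp.le, ← ENNReal.rpow_mul, ← ENNReal.rpow_mul, x1,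
            one_div_mul_cancel hp.ne', ENNReal.rpow_one, mul_assoc]
  calc ∫⁻ x, (∫⁻ y, K x y * f y ∂μ) ^ p ∂μ
      ≤ ∫⁻ x, C ^ (p / q) * (h x ^ p * ∫⁻ y, K x y * g y ∂μ) ∂μ := lintegral_mono_ae hpoint
    _ = C ^ (p / q) * ∫⁻ x, (∫⁻ y, K x y * h x ^ p * g y ∂μ) ∂μ := by
        have hmeas : Measurable fun x => ∫⁻ y, K x y * g y ∂μ :=
          Measurable.lintegral_prod_right' (f := fun z : α × α => K z.1 z.2 * g z.2)
            (hK.mul (hgm.comp measurable_snd))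
        rw [lintegral_const_mul (f := fun x => h x ^ p * ∫⁻ y, K x y * g y ∂μ) _
          ((hm.pow_const p).mul hmeas)]
        congr 1
        refine lintegral_congr fun x => ?_
        rw [← lintegral_const_mul (f := fun y => K x y * g y) _ ((hKx x).mul hgm)]
        refine lintegral_congr fun y => ?_
        ring
    _ = C ^ (p / q) * ∫⁻ y, (∫⁻ x, K x y * h x ^ p * g y ∂μ) ∂μ := by
        rw [lintegral_lintegral_swap]
        exact ((hK.mul ((hm.pow_const p).comp measurable_fst)).mul
          (hgm.comp measurable_snd)).aemeasurable
    _ ≤ C ^ (p / q) * ∫⁻ y, C * f y ^ p ∂μ := by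
        refine mul_le_mul' le_rfl ?_
        refine lintegral_mono_ae ?_
        filter_upwards [h2, hpos, hfin] with y hy hy0 hy1
        rw [lintegral_mul_const (f := fun x => K x y * h x ^ p) _ ((hKy y).mul (hm.pow_const p))]
        calc (∫⁻ x, K x y * h x ^ p ∂μ) * g y ≤ C * h y ^ p * ((h y ^ p)⁻¹ * f y ^ p) := by
              gcongr
          _ = C * (h y ^ p * (h y ^ p)⁻¹) * f y ^ p := by ring
          _ = _ := by
              rw [ENNReal.mul_inv_cancel (by simp [hy0, hy1, hp.not_gt])
                (ENNReal.rpow_ne_top_of_nonneg hp.le hy1), mul_one]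
    _ = C ^ p * ∫⁻ y, f y ^ p ∂μ := by
        rw [lintegral_const_mul _ (hf.pow_const p), ← mul_assoc]
        congr 1
        -- The constants combine to `C ^ (p / q) * C = C ^ p`, because `p / q + 1 = p`.
        nth_rewrite 2 [← ENNReal.rpow_one C]
        rw [← ENNReal.rpow_add_of_nonneg _ _ (by positivity) zero_le_one]
        congr 1
        have := hpq.inv_add_inv_eq_one
        field_simp at this ⊢
        linarith

/-- Split at `u = 1 - ρ`. Above, the denominator is at least `V u`, which leaves `V u ^ (-s) / u`;
below, it is at least `V (1 - ρ)`, which leaves the positive power `1 - s`. Both logarithmic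
integrals converge to the right size only for `0 < s < 1`. -/
theorem PowerGrowth.lintegral_rpow_div_le {V : ℝ → ℝ} {κ γ : ℝ} {k : ℕ} (h : PowerGrowth V κ γ k)
    {s : ℝ} (hs0 : 0 < s) (hs1 : s < 1) : ∃ C : ℝ, 0 ≤ C ∧ ∀ ρ : ℝ, 0 ≤ ρ → ρ < 1 →
      ∫⁻ u in Ioo 0 1, ENNReal.ofReal (V u ^ (1 - s) / u / V (1 - ρ * (1 - u))) ≤
        ENNReal.ofReal (C * V (1 - ρ) ^ (-s)) := by
  obtain ⟨C₁, hC₁, h1⟩ := h.lintegral_rpow_neg_le hs0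
  obtain ⟨C₂, hC₂, h2⟩ := h.lintegral_rpow_le (σ := 1 - s) (by linarith)
  refine ⟨C₁ + C₂, by positivity, fun ρ hρ0 hρ1 => ?_⟩
  have hδ : 0 < 1 - ρ := by linarith
  have hVδ := h.pos _ hδ
  rw [add_mul, ENNReal.ofReal_add (by positivity) (by positivity)]
  calc ∫⁻ u in Ioo 0 1,
          ENNReal.ofReal (V u ^ (1 - s) / u / V (1 - ρ * (1 - u)))
        ≤ ∫⁻ u in Ico (1 - ρ) 1 ∪ Ioo 0 (1 - ρ),
          ENNReal.ofReal (V u ^ (1 - s) / u / V (1 - ρ * (1 - u))) := by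
          refine lintegral_mono_set fun u hu => ?_
          rcases le_or_gt (1 - ρ) u with hc | hc
          · exact Or.inl ⟨hc, hu.2⟩
          · exact Or.inr ⟨hu.1, hc⟩
      _ ≤ _ := lintegral_union_le _ _ _
      _ ≤ (∫⁻ u in Ico (1 - ρ) 1, ENNReal.ofReal (V u ^ (-s) / u)) +
          ∫⁻ u in Ioo 0 (1 - ρ), ENNReal.ofReal (V (1 - ρ))⁻¹ *
            ENNReal.ofReal (V u ^ (1 - s) / u) := by
          refine add_le_add ?_ ?_
          · refine setLIntegral_mono' measurableSet_Ico fun u hu => ENNReal.ofReal_le_ofReal ?_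
            have hu0 : 0 < u := hδ.trans_le hu.1
            have hVu := h.pos u hu0
            have hle : V u ≤ V (1 - ρ * (1 - u)) :=
              h.mono (by nlinarith [hu.2])
            calc V u ^ (1 - s) / u / V (1 - ρ * (1 - u))
                ≤ V u ^ (1 - s) / u / V u := by gcongr
              _ = _ := by
                  rw [sub_eq_add_neg, Real.rpow_add hVu, Real.rpow_one]
                  field_simp
          · refine setLIntegral_mono' measurableSet_Ioo fun u hu => ?_
            have hu0 : 0 < u := hu.1
            have hVu := h.pos u hu0
            rw [← ENNReal.ofReal_mul (by positivity)]
            refine ENNReal.ofReal_le_ofReal ?_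
            have hle : V (1 - ρ) ≤ V (1 - ρ * (1 - u)) :=
              h.mono (by nlinarith [hu.1])
            rw [inv_mul_eq_div]
            gcongr
      _ ≤ _ := by
          refine add_le_add ?_ ?_
          · rw [setLIntegral_congr Ioo_ae_eq_Ico.symm]
            exact h1 _ hδ
          · rw [lintegral_const_mul' _ _ ENNReal.ofReal_ne_top]
            calc _ ≤ ENNReal.ofReal (V (1 - ρ))⁻¹ *
                    ENNReal.ofReal (C₂ * V (1 - ρ) ^ (1 - s)) := by
                  gcongr
                  exact h2 _ hδ (by linarith)
              _ = _ := by
                  rw [← ENNReal.ofReal_mul (by positivity), sub_eq_add_neg 1 s,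
                    Real.rpow_add hVδ, Real.rpow_one]
                  congr 1
                  field_simp

/-! ### The Schur estimate for the Bergman kernel -/

section

variable {ω : ℂ → ℝ} {κ γ B : ℝ} {k : ℕ}

/-- The absolute value of the kernel, extended by zero to a measurable function. -/
def absKernel (ω : ℂ → ℝ) (z ζ : ℂ) : ℝ≥0∞ :=
  ‖disc.indicator (recipSeries (moment ω)) (conj z * ζ)‖ₑ

theorem absKernel_eq {z ζ : ℂ} (hz : z ∈ disc) (hζ : ζ ∈ disc) :
    absKernel ω z ζ = ‖kernelFun ω z ζ‖ₑ := by
  rw [absKernel, indicator_of_mem (conj_mul_mem_disc hz hζ), kernelFun]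

theorem recipSeries_conj (m : ℕ → ℝ) (w : ℂ) : recipSeries m (conj w) = conj (recipSeries m w) := by
  rw [recipSeries, recipSeries, Complex.conj_tsum]
  refine tsum_congr fun n => ?_
  rw [map_mul, map_pow, Complex.conj_ofReal]

theorem absKernel_comm (z ζ : ℂ) : absKernel ω z ζ = absKernel ω ζ z := by
  have e : conj ζ * z = conj (conj z * ζ) := by rw [map_mul, Complex.conj_conj, mul_comm]
  rw [absKernel, absKernel, e]
  by_cases h : conj z * ζ ∈ disc
  · have h' : conj (conj z * ζ) ∈ disc := by rw [mem_disc] at h ⊢; rwa [RCLike.norm_conj]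
    rw [indicator_of_mem h, indicator_of_mem h', recipSeries_conj, ← ofReal_norm, ← ofReal_norm,
      RCLike.norm_conj]
  · have h' : conj (conj z * ζ) ∉ disc := by rw [mem_disc] at h ⊢; rwa [RCLike.norm_conj]
    rw [indicator_of_notMem h, indicator_of_notMem h']

theorem RegularTail.measurable_absKernel (h : RegularTail ω κ γ k B) :
    Measurable (Function.uncurry (absKernel ω)) := by
  have hd : MeasurableSet disc := isOpen_disc.measurableSet
  have h1 : Measurable (disc.indicator (recipSeries (moment ω))) := by
    classical
    rw [← piecewise_eq_indicator]
    exact h.differentiableOn_recipSeries.continuousOn.measurable_piecewise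
      continuousOn_const hd
  have h2 : Measurable fun x : ℂ × ℂ => conj x.1 * x.2 :=
    Continuous.measurable (by fun_prop)
  exact (h1.comp h2).enorm

theorem RegularTail.lintegral_circle_absKernel_le (h : RegularTail ω κ γ k B) :
    ∃ C : ℝ, 0 ≤ C ∧ ∀ z ∈ disc, ∀ r ∈ Ioo (0 : ℝ) 1,
      ∫⁻ θ in Ioo (-Real.pi) Real.pi, absKernel ω z ((r : ℂ) * circleMap 0 1 θ) ≤
        ENNReal.ofReal (C / tailMass ω (1 - ‖z‖ * r)) := by
  obtain ⟨K, A, hA0, hm, hA⟩ := h.regularSequence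
  obtain ⟨C, hC, h1⟩ := lintegral_circle_recipSeries_le h.growth hm hA0 hA
  refine ⟨C, hC, fun z hz r hr => ?_⟩
  have hn : ‖conj z * (r : ℂ)‖ = ‖z‖ * r := by
    rw [norm_mul, RCLike.norm_conj, Complex.norm_real, Real.norm_of_nonneg hr.1.le]
  have hlt := mem_disc.1 (conj_mul_mem_disc hz (mem_disc_ofReal hr.1.le hr.2))
  have := h1 (conj z * r) hlt
  rw [hn] at this
  refine le_trans (lintegral_mono fun θ => ?_) this
  have hmem : (r : ℂ) * circleMap 0 1 θ ∈ disc := by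
    rw [mem_disc, norm_mul, Complex.norm_real, Real.norm_of_nonneg hr.1.le]
    simpa using hr.2
  rw [absKernel_eq hz hmem, kernelFun, mul_assoc]

theorem RegularTail.lintegral_absKernel_mul_le_lineMeasure (h : RegularTail ω κ γ k B) (s : ℝ) :
    ∃ C : ℝ, 0 ≤ C ∧ ∀ z ∈ disc,
      ∫⁻ ζ, absKernel ω z ζ * ENNReal.ofReal (tailMass ω (1 - ‖ζ‖)) ^ (-s) ∂(weightedMeasure ω) ≤
        ∫⁻ r, ENNReal.ofReal
          (C * (tailMass ω (1 - r) ^ (-s) / tailMass ω (1 - ‖z‖ * r))) ∂(lineMeasure ω) := by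
  obtain ⟨C₀, hC₀, h0⟩ := h.lintegral_circle_absKernel_le
  refine ⟨C₀, hC₀, fun z hz => ?_⟩
  have hz' := mem_disc.1 hz
  have hρ0 := norm_nonneg z
  have hmV : Measurable (tailMass ω) := h.growth.mono.measurable
  have hmK : Measurable (absKernel ω z) := h.measurable_absKernel.of_uncurry_left
  have hmW : Measurable fun ζ : ℂ => ENNReal.ofReal (tailMass ω (1 - ‖ζ‖)) ^ (-s) :=
    (hmV.comp (measurable_const.sub measurable_norm)).ennreal_ofReal.pow_const _
  rw [h.doubling.lintegral_weightedMeasure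
    (f := fun ζ => absKernel ω z ζ * ENNReal.ofReal (tailMass ω (1 - ‖ζ‖)) ^ (-s)) (hmK.mul hmW)]
  refine lintegral_mono_ae ?_
  filter_upwards [ae_lineMeasure_mem ω] with r hr
  have hVr := h.growth.pos (1 - r) (by linarith [hr.2])
  have hVρr := h.growth.pos (1 - ‖z‖ * r) (by nlinarith [hr.1, hr.2])
  have hnr : ∀ θ, ‖(r : ℂ) * circleMap 0 1 θ‖ = r := fun θ => by simp [abs_of_pos hr.1]
  simp only [hnr]
  rw [ENNReal.ofReal_rpow_of_pos hVr, lintegral_mul_const' _ _ ENNReal.ofReal_ne_top]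
  -- The Jacobian factor `r / π` is at most `1` and is dropped.
  have hr1 : Real.pi⁻¹ * r ≤ 1 := by
    have h3 : Real.pi⁻¹ ≤ 1 := inv_le_one_of_one_le₀ (by linarith [Real.pi_gt_three])
    nlinarith [hr.1, hr.2]
  calc _ ≤ ENNReal.ofReal 1 * (ENNReal.ofReal (C₀ / tailMass ω (1 - ‖z‖ * r)) *
          ENNReal.ofReal (tailMass ω (1 - r) ^ (-s))) :=
        mul_le_mul' (ENNReal.ofReal_le_ofReal hr1) (mul_le_mul' (h0 z hz r hr) le_rfl)
    _ = _ := by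
        rw [ENNReal.ofReal_one, one_mul, ← ENNReal.ofReal_mul (by positivity)]
        congr 1
        ring

/-- The estimate behind Schur's test for the Bergman kernel. -/
theorem RegularTail.lintegral_absKernel_mul_le (h : RegularTail ω κ γ k B) {s : ℝ} (hs0 : 0 < s)
    (hs1 : s < 1) : ∃ C : ℝ, 0 ≤ C ∧ ∀ z ∈ disc,
      ∫⁻ ζ, absKernel ω z ζ * ENNReal.ofReal (tailMass ω (1 - ‖ζ‖)) ^ (-s) ∂(weightedMeasure ω) ≤
        ENNReal.ofReal C * ENNReal.ofReal (tailMass ω (1 - ‖z‖)) ^ (-s) := by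
  obtain ⟨C₀, hC₀, h0⟩ := h.lintegral_absKernel_mul_le_lineMeasure s
  obtain ⟨C₁, hC₁, h1⟩ := h.growth.lintegral_rpow_div_le hs0 hs1
  have hB := h.bound_nonneg
  refine ⟨C₀ * B * C₁, by positivity, fun z hz => ?_⟩
  have hz' := mem_disc.1 hz
  have hρ0 := norm_nonneg z
  have hVδ := h.growth.pos (1 - ‖z‖) (by linarith)
  have hV := h.growth.pos
  have h0z := h0 z hz
  generalize ‖z‖ = ρ at *
  calc _ ≤ ∫⁻ r in Ioo (1 - 1) (1 - 0), ENNReal.ofReal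
          (C₀ * (tailMass ω (1 - r) ^ (-s) / tailMass ω (1 - ρ * r))) ∂(lineMeasure ω) := by
        rw [sub_self, sub_zero, ← lintegral_lineMeasure_eq_Ioo]
        exact h0z
    _ ≤ ∫⁻ u in Ioo 0 1, ENNReal.ofReal (B * (tailMass ω u / u)) * ENNReal.ofReal
          (C₀ * (tailMass ω (1 - (1 - u)) ^ (-s) / tailMass ω (1 - ρ * (1 - u)))) :=
        h.setLIntegral_le (a := 0) (b := 1) _ (le_refl 0) (le_refl 1)
    _ = ∫⁻ u in Ioo 0 1, ENNReal.ofReal (C₀ * B) *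
          ENNReal.ofReal (tailMass ω u ^ (1 - s) / u / tailMass ω (1 - ρ * (1 - u))) := by
        refine setLIntegral_congr_fun measurableSet_Ioo fun u hu => ?_
        have hu0 := hu.1
        have hVu := hV u hu.1
        have hVρ := hV (1 - ρ * (1 - u)) (by nlinarith [hu.1, hu.2])
        rw [← ENNReal.ofReal_mul (by positivity), ← ENNReal.ofReal_mul (by positivity),
          sub_sub_cancel, sub_eq_add_neg 1 s, Real.rpow_add hVu, Real.rpow_one]
        congr 1
        ring
    _ = ENNReal.ofReal (C₀ * B) * ∫⁻ u in Ioo 0 1,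
          ENNReal.ofReal (tailMass ω u ^ (1 - s) / u / tailMass ω (1 - ρ * (1 - u))) :=
        lintegral_const_mul' _ _ ENNReal.ofReal_ne_top
    _ ≤ ENNReal.ofReal (C₀ * B) * ENNReal.ofReal (C₁ * tailMass ω (1 - ρ) ^ (-s)) :=
        mul_le_mul' le_rfl (h1 _ hρ0 hz')
    _ = _ := by
        rw [ENNReal.ofReal_rpow_of_pos hVδ, ← ENNReal.ofReal_mul (by positivity),
          ← ENNReal.ofReal_mul (by positivity), ← mul_assoc]

/-- The maximal Bergman projection is bounded on the cone of nonnegative functions. -/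
theorem RegularTail.lintegral_rpow_absKernel_le (h : RegularTail ω κ γ k B) {p : ℝ} (hp : 1 < p) :
    ∃ C : ℝ≥0, ∀ f : ℂ → ℝ≥0∞, Measurable f →
      ∫⁻ z, (∫⁻ ζ, absKernel ω z ζ * f ζ ∂(weightedMeasure ω)) ^ p ∂(weightedMeasure ω) ≤
        (C : ℝ≥0∞) ^ p * ∫⁻ ζ, f ζ ^ p ∂(weightedMeasure ω) := by
  have hfin := h.doubling.isFiniteMeasure_weightedMeasure
  have hpq := Real.HolderConjugate.conjExponent hp
  set q := p.conjExponent with hq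
  have hp0 : 0 < p := hpq.pos
  have hq0 : 0 < q := hpq.symm.pos
  have hq1 : 1 < q := hpq.symm.lt
  obtain ⟨C₁, hC₁, h1⟩ := h.lintegral_absKernel_mul_le (s := 1 / p) (by positivity)
    (by rw [div_lt_one hp0]; exact hp)
  obtain ⟨C₂, hC₂, h2⟩ := h.lintegral_absKernel_mul_le (s := 1 / q) (by positivity)
    (by rw [div_lt_one hq0]; exact hq1)
  refine ⟨Real.toNNReal (C₁ + C₂), fun f hf => ?_⟩
  have hmV : Measurable (tailMass ω) := h.growth.mono.measurable
  -- The exponent `1 / (p * q)` makes `H ^ q` and `H ^ p` the powers of exponents `-1 / p` and `-1 /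
  -- q` of the tail, both admissible in the kernel estimate. Symmetry of the kernel gives the second
  -- Schur condition.
  set H : ℂ → ℝ≥0∞ := fun ζ => ENNReal.ofReal (tailMass ω (1 - ‖ζ‖)) ^ (-(1 / (p * q))) with hH
  have hHq : ∀ ζ, H ζ ^ q = ENNReal.ofReal (tailMass ω (1 - ‖ζ‖)) ^ (-(1 / p)) := fun ζ => by
    rw [hH, ← ENNReal.rpow_mul]
    congr 1
    field_simp
  have hHp : ∀ ζ, H ζ ^ p = ENNReal.ofReal (tailMass ω (1 - ‖ζ‖)) ^ (-(1 / q)) := fun ζ => by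
    rw [hH, ← ENNReal.rpow_mul]
    congr 1
    field_simp
  have hV : ∀ ζ ∈ disc, 0 < tailMass ω (1 - ‖ζ‖) := fun ζ hζ =>
    h.growth.pos _ (by linarith [mem_disc.1 hζ])
  refine lintegral_rpow_lintegral_mul_le_of_schur (h := H) h.measurable_absKernel
    ((ENNReal.measurable_ofReal.comp (hmV.comp (by fun_prop))).pow_const _) ?_ ?_ hpq ?_ ?_ hf
  · filter_upwards [ae_weightedMeasure_mem ω] with ζ hζ
    have := hV ζ hζ
    simp only [hH]
    rw [ENNReal.ofReal_rpow_of_pos this, ne_eq, ENNReal.ofReal_eq_zero, not_le]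
    positivity
  · filter_upwards [ae_weightedMeasure_mem ω] with ζ hζ
    simp only [hH]
    rw [ENNReal.ofReal_rpow_of_pos (hV ζ hζ)]
    exact ENNReal.ofReal_ne_top
  · filter_upwards [ae_weightedMeasure_mem ω] with z hz
    simp only [hHq]
    refine (h1 z hz).trans ?_
    gcongr
    exact ENNReal.ofReal_le_ofReal (by linarith)
  · filter_upwards [ae_weightedMeasure_mem ω] with z hz
    simp only [hHp, absKernel_comm _ z]
    refine (h2 z hz).trans ?_
    gcongr
    exact ENNReal.ofReal_le_ofReal (by linarith)

end

end BergmanProj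

end

/-! ### The theorem -/

theorem theorem4p1 (p : ℝ≥0∞) (hp : 1 < p) (hp' : p < ∞) (ω : ℂ → ℝ)
    (hω : BergmanProj.IsRegular ω) (hω0 : ∃ z ∈ BergmanProj.disc, ω z ≠ 0) :
    (∀ z ∈ BergmanProj.disc,
      BergmanProj.IsReproducingKernelAt ω z (BergmanProj.bergmanKernel ω z)) ∧
    ∃ C : ℝ≥0, ∀ f : ℂ → ℂ, MemLp f p (BergmanProj.weightedMeasure ω) →
      (∀ z ∈ BergmanProj.disc,
        Integrable (fun ζ => f ζ * conj (BergmanProj.bergmanKernel ω z ζ))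
          (BergmanProj.weightedMeasure ω)) ∧
      (MemLp (BergmanProj.bergmanProjPos ω f) p (BergmanProj.weightedMeasure ω) ∧
        eLpNorm (BergmanProj.bergmanProjPos ω f) p (BergmanProj.weightedMeasure ω) ≤
          C * eLpNorm f p (BergmanProj.weightedMeasure ω)) ∧
      (BergmanProj.MemBergman ω p (BergmanProj.bergmanProj ω f) ∧
        eLpNorm (BergmanProj.bergmanProj ω f) p (BergmanProj.weightedMeasure ω) ≤
          C * eLpNorm f p (BergmanProj.weightedMeasure ω)) := by
  open BergmanProj in
  obtain ⟨κ, γ, k, B, h⟩ := hω.regularTail hω0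
  have hfin := h.doubling.isFiniteMeasure_weightedMeasure
  refine ⟨fun z hz => h.isReproducingKernelAt_bergmanKernel hz, ?_⟩
  have hp0 : p ≠ 0 := (zero_lt_one.trans hp).ne'
  have hpr : 1 < p.toReal := by
    rw [← ENNReal.toReal_one]; exact (ENNReal.toReal_lt_toReal ENNReal.one_ne_top hp'.ne).2 hp
  have hpr0 : 0 < p.toReal := one_pos.trans hpr
  obtain ⟨C, hC⟩ := h.lintegral_rpow_absKernel_le hpr
  refine ⟨C, fun f hf => ?_⟩
  have hfi : Integrable f (weightedMeasure ω) := hf.integrable hp.le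
  -- Schur's test is stated for measurable functions, so `f` is replaced by a measurable
  -- representative. The resulting `Q` equals the positive operator on the disc and dominates both
  -- operators there.
  set g := hf.aestronglyMeasurable.mk f with hg
  have hgm : Measurable fun ζ => ‖g ζ‖ₑ :=
    hf.aestronglyMeasurable.stronglyMeasurable_mk.measurable.enorm
  have hfg : f =ᵐ[weightedMeasure ω] g := hf.aestronglyMeasurable.ae_eq_mk
  set Q : ℂ → ℝ≥0∞ := fun z => ∫⁻ ζ, absKernel ω z ζ * ‖g ζ‖ₑ ∂(weightedMeasure ω) with hQ
  have hQm : Measurable Q := Measurable.lintegral_prod_right'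
    (f := fun x : ℂ × ℂ => absKernel ω x.1 x.2 * ‖g x.2‖ₑ)
    (h.measurable_absKernel.mul (hgm.comp measurable_snd))
  have hQf : ∀ z ∈ disc, ∫⁻ ζ, ‖f ζ‖ₑ * ‖bergmanKernel ω z ζ‖ₑ ∂(weightedMeasure ω) = Q z := by
    intro z hz
    refine lintegral_congr_ae ?_
    filter_upwards [hfg, h.bergmanKernel_ae_eq hz, ae_weightedMeasure_mem ω] with ζ h1 h2 h3
    rw [h1, h2, absKernel_eq hz h3, mul_comm]
  have hnorm : ∀ {E : Type} [NormedAddCommGroup E] {F : ℂ → E},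
      (∀ z ∈ disc, ‖F z‖ₑ ≤ Q z) →
      eLpNorm F p (weightedMeasure ω) ≤ C * eLpNorm f p (weightedMeasure ω) := by
    intro E _ F hF
    rw [eLpNorm_congr_ae hfg, eLpNorm_eq_lintegral_rpow_enorm_toReal hp0 hp'.ne,
      eLpNorm_eq_lintegral_rpow_enorm_toReal hp0 hp'.ne]
    calc (∫⁻ z, ‖F z‖ₑ ^ p.toReal ∂(weightedMeasure ω)) ^ (1 / p.toReal)
        ≤ ((C : ℝ≥0∞) ^ p.toReal *
            ∫⁻ ζ, ‖g ζ‖ₑ ^ p.toReal ∂(weightedMeasure ω)) ^ (1 / p.toReal) := by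
          gcongr
          refine le_trans (lintegral_mono_ae ?_) (hC _ hgm)
          filter_upwards [ae_weightedMeasure_mem ω] with z hz
          gcongr
          exact hF z hz
      _ = _ := by
          rw [ENNReal.mul_rpow_of_nonneg _ _ (by positivity), ← ENNReal.rpow_mul,
            mul_one_div_cancel hpr0.ne', ENNReal.rpow_one]
  have hbound : (C : ℝ≥0∞) * eLpNorm f p (weightedMeasure ω) < ∞ :=
    ENNReal.mul_lt_top ENNReal.coe_lt_top hf.2
  have hint : ∀ z ∈ disc, Integrable (fun ζ => f ζ * conj (bergmanKernel ω z ζ))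
      (weightedMeasure ω) := by
    intro z hz
    refine (h.integrable_mul_kernelFun hz hfi).congr ?_
    filter_upwards [h.bergmanKernel_ae_eq hz] with ζ h1
    rw [h1]
  have hposn : ∀ z ∈ disc, bergmanProjPos ω f z = (Q z).toReal := by
    intro z hz
    rw [← hQf z hz, bergmanProjPos, integral_eq_lintegral_of_nonneg_ae]
    · congr 1
      refine lintegral_congr fun ζ => ?_
      rw [ENNReal.ofReal_mul (norm_nonneg _), ofReal_norm, ofReal_norm]
    · exact Filter.Eventually.of_forall fun ζ => by positivity
    · refine (hint z hz).aestronglyMeasurable.norm.congr ?_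
      refine Filter.Eventually.of_forall fun ζ => ?_
      simp only [norm_mul, RCLike.norm_conj]
  have hpos : ∀ z ∈ disc, ‖bergmanProjPos ω f z‖ₑ ≤ Q z := by
    intro z hz
    rw [hposn z hz, ← ofReal_norm, Real.norm_of_nonneg ENNReal.toReal_nonneg]
    exact ENNReal.ofReal_toReal_le
  have hproj : ∀ z ∈ disc, ‖bergmanProj ω f z‖ₑ ≤ Q z := by
    intro z hz
    rw [← hQf z hz, bergmanProj]
    refine (enorm_integral_le_lintegral_enorm _).trans_eq (lintegral_congr fun ζ => ?_)
    rw [enorm_mul, ← ofReal_norm (conj _), RCLike.norm_conj, ofReal_norm]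
  -- Analyticity comes from the power series with coefficients `(∫ f ζ * conj ζ ^ n) / m n`, whose
  -- integrals are bounded by the `L^1_ω` norm of `f`.
  have hdiff : DifferentiableOn ℂ (bergmanProj ω f) disc := by
    set a : ℕ → ℂ := fun n => (((moment ω n)⁻¹ : ℝ) : ℂ) *
      (∫ ζ, f ζ * conj ζ ^ n ∂(weightedMeasure ω)) with ha
    have hd : DifferentiableOn ℂ (fun z => ∑' n, a n * z ^ n) disc := by
      refine differentiableOn_tsum_pow fun ρ h0 h1 => ?_
      refine Summable.of_nonneg_of_le (fun n => by positivity) (fun n => ?_)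
        ((h.summable_inv_moment h0 h1).mul_right (∫ ζ, ‖f ζ‖ ∂(weightedMeasure ω)))
      have := h.moment_pos n
      rw [ha, norm_mul, h.norm_inv_moment, mul_right_comm]
      gcongr
      exact (norm_integral_le_integral_norm _).trans (norm_integral_mul_conj_pow_le hfi n)
    refine hd.congr fun z hz => ?_
    rw [(h.hasSum_integral_kernelFun hz hfi).tsum_eq, bergmanProj]
    refine integral_congr_ae ?_
    filter_upwards [h.bergmanKernel_ae_eq hz] with ζ h1
    rw [h1]
  refine ⟨hint, ⟨⟨?_, (hnorm hpos).trans_lt hbound⟩, hnorm hpos⟩,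
    ⟨hdiff, aestronglyMeasurable_weightedMeasure hdiff.continuousOn,
      (hnorm hproj).trans_lt hbound⟩, hnorm hproj⟩
  refine hQm.ennreal_toReal.aestronglyMeasurable.congr ?_
  filter_upwards [ae_weightedMeasure_mem ω] with z hz
  exact (hposn z hz).symm
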